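/- Fix a reference frequency $\omega_0>0$, a nominal voltage $V_0>0$ and $\mathbb J=\begin{bmatrix}0&1\\-1&0\end{bmatrix}$; voltages and currents are $dq$ vectors in $\mathbb R^2$. **Loads.** A static load has a current map $I(V)$, $V\in\mathbb R^2\setminus\{0\}$, $v=\sqrt{V_d^2+V_q^2}$, of the form $I(V)=g(v)V+b(v)\,\mathbb J V$, where either (ZIP) $g=\frac{P_p}{v^2}+\frac{I_p}{v}+Y_p$, $b=\frac{P_q}{v^2}+\frac{I_q}{v}+Y_q$, or (EXP) $g=P_0v^{n_p-2}/V_0^{n_p}$, $b=Q_0v^{n_q-2}/V_0^{n_q}$; all load parameters are $\ge 0$. The *load EIP conditions* at amplitude $v$ are, for ZIP, $$Y_p+\tfrac{I_p}{2v}>0,\qquad Y_p^2v^4+Y_pI_pv^3>\tfrac14I_q^2v^2+(I_pP_p+I_qP_q)v+P_p^2+P_q^2,$$ and, for EXP, $n_pP_0>0$ and $4(n_p-1)P_0^2(v/V_0)^{2n_p}>(n_q-2)^2Q_0^2(v/V_0)^{2n_q}$. **Subsystems** (input $d$, output $z$). (i) DGU with IDA-PBC and integral action, $L_t,C_t>0$,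 $\alpha_{aa}<0$, $\nu_{aa}>0$, $k_{Ia}>0$ $(a=1,2)$, reference $V^*\in\mathbb R^2$: state $\varkappa=(\varkappa_\alpha,\varkappa_\nu,\varkappa_e)\in\mathbb R^6$, $V=\varkappa_\nu/C_t$, $z=V$ and $$\dot\varkappa=(J-R)Q(\varkappa-\varkappa^\circ)+\begin{bmatrix}0\\ \mathbf 1\\0\end{bmatrix}(d-I(V)),\quad J=\begin{bmatrix}0&-N&0\\N&\omega_0C_t\mathbb J&-k\\0&k&0\end{bmatrix},$$ $N=\mathrm{Diag}(\nu_{11},\nu_{22})$, $k=\mathrm{Diag}(k_{I1},k_{I2})$, $R=\mathrm{Diag}(-\alpha_{11},-\alpha_{22},0,0,0,0)$, $Q=\mathrm{Diag}(\frac1{L_t\nu_{11}},\frac1{L_t\nu_{22}},\frac1{C_t},\frac1{C_t},\frac1{k_{I1}},\frac1{k_{I2}})$, $\varkappa^\circ=(\bar\varkappa_\alpha,C_tV^*,0)$ with a constant $\bar\varkappa_\alpha\in\mathbb R^2$. Here $I$ is the current map of an optional local ZIP/EXP load ($I=0$ if there is none). Its shifted Hamiltonian is $\frac12(\varkappa-\bar\varkappa)^{\mathsf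 T}Q(\varkappa-\bar\varkappa)$. (ii) PI-controlled DGU, $L_t,C_t>0$, $R_t\ge0$, gains $K_{11},K_{12},K_{13}\in\mathbb R^{2\times2}$, reference $V^*$: state $x=(C_tV,L_tI_t,\mathsf v)\in\mathbb R^6$, $z=V$, $$\dot x=Fx+(0,0,V^*)+(d-I(V),0,0),\quad F=\begin{bmatrix}\omega_0\mathbb J&\frac1{L_t}\mathbf 1&0\\-\frac1{C_t}(\mathbf 1-K_{11})&-\frac{R_t}{L_t}\mathbf 1+\omega_0\mathbb J+\frac1{L_t}K_{12}&K_{13}\\-\frac1{C_t}\mathbf 1&0&0\end{bmatrix},$$ with $I$ an optional local load as above. The gains are tuned so that, for some symmetric positive definite $P_{22}\in\mathbb R^{4\times4}$ and $P=\mathrm{blockdiag}(\frac1{C_t}\mathbf 1,P_{22})$, $F^{\mathsf T}P+PF\preceq0$ (the closed-loop DGU is EIP), and so that $F$ is Hurwitz (the isolated closed-loop DGU is asymptotically stable). Its shifted Hamiltonian is $\frac12(x-\bar x)^{\mathsf T}P(x-\bar x)$. (iii) Lone-standing ZIP/EXP load node with capacitance $C_j>0$: state $x=C_jV$, $\dot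 x=\omega_0C_j\mathbb JV-I(V)+d$, $z=V$, shifted Hamiltonian $\frac1{2C_j}\|x-\bar x\|^2$. (iv) $\Pi$-model line ($RL$ part) with $R_l,L_l>0$ from node $a$ to node $b$: state $x=L_lI_l$, $\dot x=(\omega_0L_l\mathbb J-R_l\mathbf 1)I_l+V_a-V_b$, input $d=(V_a,V_b)$, output $z=(I_l,-I_l)$, shifted Hamiltonian $\frac1{2L_l}\|x-\bar x\|^2$. **Microgrid.** $D$ DGUs, each of type (i) or (ii), and $L$ load nodes are connected in an arbitrary topology by $P$ oriented lines; the input of a node is the sum of the currents of the lines ending there minus the sum of the currents of the lines starting there. This gives an autonomous composite system $\dot x=f(x)$ on $\mathbb R^{2(3D+L+P)}$. Let $\mathcal X_{\rm MG}$ be the set of states in which the voltage at every load (local or lone-standing) is nonzero and its amplitude satisfies the load EIP conditions of that load, and let $H_{\rm MG}(x,\bar x)$ be the sum of all subsystems' shifted Hamiltonians. A system $\dot x=f(x,d)$, $z=h(x)$ is *EIP on $\mathcal X$ with storage function $S$* if $S(x,\bar x)\ge0$ is $C^1$, $S(\bar x,\bar x)=0$, and for all $x,\bar x\in\mathcal X$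 and all $d,\bar d$ with $f(\bar x,\bar d)=0$ one has $\dot S=\partial_xS(x,\bar x)f(x,d)\le(d-\bar d)^{\mathsf T}(h(x)-h(\bar x))$. **Theorem.** The composite system (which has no open ports, so that its supply rate is $0$) is EIP on $\mathcal X_{\rm MG}$ with storage function $H_{\rm MG}$. For every equilibrium $\bar x\in\mathcal X_{\rm MG}$ of the microgrid, $\mathcal X_{\rm MG}$ is a neighbourhood of $\bar x$, the function $x\mapsto H_{\rm MG}(x,\bar x)$ is a Lyapunov function on it ($C^1$, zero at $\bar x$, positive for $x\ne\bar x$, and $\dot H_{\rm MG}\le0$ on $\mathcal X_{\rm MG}$), and $\bar x$ is asymptotically stable: solutions starting near $\bar x$ exist for all $t\ge0$, and $\bar x$ is Lyapunov stable and locally attractive. -/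

import Mathlib

open Matrix Filter Topology

noncomputable section

/-! ### Open systems, equilibrium-independent passivity, stability -/

/-- A subsystem `ẋ = dyn x d`, `z = out x` with state `x ∈ ℝⁿ`, coupling input `d ∈ ℝᵐ` and
coupling output `z ∈ ℝᵐ`. (No subsystem below has direct feed-through.) -/
structure OpenSystem (n m : Type) where
  dyn : (n → ℝ) → (m → ℝ) → (n → ℝ)
  out : (n → ℝ) → (m → ℝ)

/-- Equilibrium-independent passivity on the set `X` of admissible states, with the `C¹` storage
function `S x x̄`: for every equilibrium `x̄ ∈ X` with input `d̄`, every `x ∈ X` and every input `d`,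
the derivative of `S · x̄` along the dynamics is at most the shifted supply rate. -/
def OpenSystem.IsEIPWith {n m : Type} [Fintype n] [Fintype m] (sys : OpenSystem n m)
    (X : Set (n → ℝ)) (S : (n → ℝ) → (n → ℝ) → ℝ) : Prop :=
  ContDiff ℝ 1 (fun p : (n → ℝ) × (n → ℝ) => S p.1 p.2) ∧
  (∀ x xbar, 0 ≤ S x xbar) ∧
  (∀ xbar, S xbar xbar = 0) ∧
  ∀ x ∈ X, ∀ xbar ∈ X, ∀ d dbar, sys.dyn xbar dbar = 0 →
    fderiv ℝ (fun y => S y xbar) x (sys.dyn x d) ≤ (d - dbar) ⬝ᵥ (sys.out x - sys.out xbar)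

/-- `W` is a Lyapunov function for `ẋ = f x` and the point `xbar` on its neighbourhood `X`:
it is `C¹`, positive definite about `xbar`, and does not increase along the dynamics in `X`. -/
structure IsLyapunovFunctionOn {E : Type} [NormedAddCommGroup E] [NormedSpace ℝ E]
    (f : E → E) (X : Set E) (xbar : E) (W : E → ℝ) : Prop where
  nhds : X ∈ 𝓝 xbar
  contDiff : ContDiff ℝ 1 W
  zero : W xbar = 0
  pos : ∀ x, x ≠ xbar → 0 < W x
  nonincreasing : ∀ x ∈ X, fderiv ℝ W x (f x) ≤ 0

/-- `γ` solves `ẋ = f x` on `[0, ∞)`. -/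
def IsSolution {E : Type} [NormedAddCommGroup E] [NormedSpace ℝ E]
    (f : E → E) (γ : ℝ → E) : Prop :=
  ∀ t, 0 ≤ t → HasDerivWithinAt γ (f (γ t)) (Set.Ici 0) t

/-- `xbar` is an asymptotically stable equilibrium of `ẋ = f x`: near `xbar` solutions exist for
all `t ≥ 0`, and `xbar` is Lyapunov stable and attractive. -/
structure IsAsymptoticallyStable {E : Type} [NormedAddCommGroup E] [NormedSpace ℝ E]
    (f : E → E) (xbar : E) : Prop where
  equilibrium : f xbar = 0
  exists_solution : ∃ δ > 0, ∀ x₀, dist x₀ xbar < δ → ∃ γ, IsSolution f γ ∧ γ 0 = x₀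
  stable : ∀ ε > 0, ∃ δ > 0, ∀ γ, IsSolution f γ → dist (γ 0) xbar < δ →
    ∀ t, 0 ≤ t → dist (γ t) xbar < ε
  attractive : ∃ δ > 0, ∀ γ, IsSolution f γ → dist (γ 0) xbar < δ → Tendsto γ atTop (𝓝 xbar)

/-! ### Static loads -/

/-- The amplitude `√(V_d² + V_q²)` of a `dq` vector. -/
def dqAmplitude (V : Fin 2 → ℝ) : ℝ := √(V 0 ^ 2 + V 1 ^ 2)

/-- The matrix `[0, 1; -1, 0]`. -/
def dqRot : Matrix (Fin 2) (Fin 2) ℝ := !![0, 1; -1, 0]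

/-- A static AC load: constant impedance/current/power parameters (`p` active, `q` reactive), or
nominal powers `P0`, `Q0` with exponents `np`, `nq`. -/
inductive StaticLoad where
  | zip (Yp Ip Pp Yq Iq Pq : ℝ)
  | exp (P0 Q0 np nq : ℝ)

namespace StaticLoad

/-- All load parameters are non-negative. -/
def Nonneg : StaticLoad → Prop
  | zip Yp Ip Pp Yq Iq Pq => 0 ≤ Yp ∧ 0 ≤ Ip ∧ 0 ≤ Pp ∧ 0 ≤ Yq ∧ 0 ≤ Iq ∧ 0 ≤ Pq
  | exp P0 Q0 np nq => 0 ≤ P0 ∧ 0 ≤ Q0 ∧ 0 ≤ np ∧ 0 ≤ nq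

/-- The load current as a function of the `dq` voltage (meaningful for `V ≠ 0`), with nominal
voltage `V₀`. -/
def current (V₀ : ℝ) : StaticLoad → (Fin 2 → ℝ) → (Fin 2 → ℝ)
  | zip Yp Ip Pp Yq Iq Pq, V =>
    ![(Pp * V 0 + Pq * V 1) / dqAmplitude V ^ 2 + (Ip * V 0 + Iq * V 1) / dqAmplitude V
        + Yp * V 0 + Yq * V 1,
      (Pp * V 1 - Pq * V 0) / dqAmplitude V ^ 2 + (Ip * V 1 - Iq * V 0) / dqAmplitude V
        + Yp * V 1 - Yq * V 0]
  | exp P0 Q0 np nq, V =>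
    ![P0 * dqAmplitude V ^ (np - 2) / V₀ ^ np * V 0 + Q0 * dqAmplitude V ^ (nq - 2) / V₀ ^ nq * V 1,
      P0 * dqAmplitude V ^ (np - 2) / V₀ ^ np * V 1 - Q0 * dqAmplitude V ^ (nq - 2) / V₀ ^ nq * V 0]

/-- The load passivity conditions at the voltage amplitude `v`. -/
def PassivityCondition (V₀ : ℝ) : StaticLoad → ℝ → Prop
  | zip Yp Ip Pp _ Iq Pq, v =>
    0 < Yp + Ip / (2 * v) ∧
    (1 / 4) * Iq ^ 2 * v ^ 2 + (Ip * Pp + Iq * Pq) * v + (Pp ^ 2 + Pq ^ 2)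
      < Yp ^ 2 * v ^ 4 + Yp * Ip * v ^ 3
  | exp P0 Q0 np nq, v =>
    0 < np * P0 ∧
    (nq - 2) ^ 2 * Q0 ^ 2 * (v / V₀) ^ (2 * nq) < 4 * (np - 1) * P0 ^ 2 * (v / V₀) ^ (2 * np)

/-- `V` is an admissible voltage: it is nonzero and its amplitude satisfies the load passivity
conditions. -/
def Admissible (V₀ : ℝ) (ld : StaticLoad) (V : Fin 2 → ℝ) : Prop :=
  V ≠ 0 ∧ ld.PassivityCondition V₀ (dqAmplitude V)

end StaticLoad

/-- Current drawn by an optional local load. -/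
def localCurrent (V₀ : ℝ) : Option StaticLoad → (Fin 2 → ℝ) → (Fin 2 → ℝ)
  | none, _ => 0
  | some ld, V => ld.current V₀ V

/-! ### Controlled DGUs -/

/-- Index of the six states of a closed-loop DGU: three consecutive `dq` pairs. -/
abbrev DGUIx : Type := Fin 2 ⊕ Fin 2 ⊕ Fin 2

/-- A DGU under IDA-PBC with integral action. The state is `ϰ = (ϰ_α, ϰ_ν, ϰ_e)`: transformed
filter currents, capacitor charges `ϰ_ν = C_t V`, integrator states. `kalpha` is the constant
`ϰ̄_α` of the coordinate change. -/
structure PHSDGU where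
  Lt : ℝ
  Ct : ℝ
  alpha : Fin 2 → ℝ
  nu : Fin 2 → ℝ
  kI : Fin 2 → ℝ
  Vref : Fin 2 → ℝ
  kalpha : Fin 2 → ℝ

namespace PHSDGU

/-- Positive filter parameters and the sign conditions on the control parameters. -/
def Valid (g : PHSDGU) : Prop :=
  0 < g.Lt ∧ 0 < g.Ct ∧ (∀ a, g.alpha a < 0) ∧ (∀ a, 0 < g.nu a) ∧ (∀ a, 0 < g.kI a)

/-- Interconnection matrix. -/
def J (g : PHSDGU) (ω₀ : ℝ) : Matrix DGUIx DGUIx ℝ :=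
  fromBlocks 0 (fromCols (-diagonal g.nu) 0)
    (fromRows (diagonal g.nu) 0)
    (fromBlocks ((ω₀ * g.Ct) • dqRot) (-diagonal g.kI) (diagonal g.kI) 0)

/-- Damping matrix. -/
def R (g : PHSDGU) : Matrix DGUIx DGUIx ℝ :=
  diagonal (Sum.elim (fun a => -g.alpha a) (fun _ => 0))

/-- Energy matrix. -/
def Q (g : PHSDGU) : Matrix DGUIx DGUIx ℝ :=
  diagonal (Sum.elim (fun a => 1 / (g.Lt * g.nu a))
    (Sum.elim (fun _ => 1 / g.Ct) (fun a => 1 / g.kI a)))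

/-- Interaction matrix. -/
def K : Matrix DGUIx (Fin 2) ℝ := fromRows 0 (fromRows 1 0)

/-- Node voltage. -/
def voltage (g : PHSDGU) (x : DGUIx → ℝ) : Fin 2 → ℝ := fun a => x (.inr (.inl a)) / g.Ct

/-- Minimiser of the closed-loop Hamiltonian of the unconnected DGU. -/
def center (g : PHSDGU) : DGUIx → ℝ :=
  Sum.elim g.kalpha (Sum.elim (fun a => g.Ct * g.Vref a) (fun _ => 0))

/-- Closed-loop port-Hamiltonian DGU with optional local load; the output is the node voltage. -/
def system (g : PHSDGU) (ω₀ V₀ : ℝ) (ld : Option StaticLoad) : OpenSystem DGUIx (Fin 2) where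
  dyn x d := (g.J ω₀ - g.R) *ᵥ (g.Q *ᵥ (x - g.center)) + K *ᵥ d
    - K *ᵥ localCurrent V₀ ld (g.voltage x)
  out x := g.voltage x

end PHSDGU

/-- A DGU under multivariable PI control. The state is `(C_t V, L_t I, v)` with integrator
`v̇ = V_ref - V`; the input is `u = K11 V + K12 I + K13 v`. `P22` is the free block of the matrix
of the quadratic storage function. -/
structure PIDGU where
  Rt : ℝ
  Lt : ℝ
  Ct : ℝ
  K11 : Matrix (Fin 2) (Fin 2) ℝ
  K12 : Matrix (Fin 2) (Fin 2) ℝ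
  K13 : Matrix (Fin 2) (Fin 2) ℝ
  Vref : Fin 2 → ℝ
  P22 : Matrix (Fin 2 ⊕ Fin 2) (Fin 2 ⊕ Fin 2) ℝ

namespace PIDGU

/-- Closed-loop system matrix. -/
def F (g : PIDGU) (ω₀ : ℝ) : Matrix DGUIx DGUIx ℝ :=
  fromBlocks (ω₀ • dqRot) (fromCols ((1 / g.Lt) • 1) 0)
    (fromRows (-(1 / g.Ct) • (1 - g.K11)) (-(1 / g.Ct) • 1))
    (fromBlocks (-(g.Rt / g.Lt) • 1 + ω₀ • dqRot + (1 / g.Lt) • g.K12) g.K13 0 0)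

/-- Matrix of the storage function. -/
def Pmat (g : PIDGU) : Matrix DGUIx DGUIx ℝ :=
  fromBlocks ((1 / g.Ct) • 1) 0 0 g.P22

/-- Interaction matrix. -/
def K : Matrix DGUIx (Fin 2) ℝ := fromRows 1 0

/-- Positive filter parameters, and gains tuned such that the closed-loop DGU is EIP with the
storage matrix `Pmat` and that the isolated closed-loop DGU is asymptotically stable, i.e. `F` is
Hurwitz. -/
def Valid (g : PIDGU) (ω₀ : ℝ) : Prop :=
  0 ≤ g.Rt ∧ 0 < g.Lt ∧ 0 < g.Ct ∧ g.P22.PosDef ∧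
  (-((g.F ω₀)ᵀ * g.Pmat + g.Pmat * g.F ω₀)).PosSemidef ∧
  ∀ μ ∈ spectrum ℂ ((g.F ω₀).map (algebraMap ℝ ℂ)), μ.re < 0

/-- Node voltage. -/
def voltage (g : PIDGU) (x : DGUIx → ℝ) : Fin 2 → ℝ := fun a => x (.inl a) / g.Ct

/-- PI-controlled DGU with optional local load; the output is the node voltage. -/
def system (g : PIDGU) (ω₀ V₀ : ℝ) (ld : Option StaticLoad) : OpenSystem DGUIx (Fin 2) where
  dyn x d := g.F ω₀ *ᵥ x
    + (Sum.elim (fun _ => 0) (Sum.elim (fun _ => 0) g.Vref) : DGUIx → ℝ) + K *ᵥ d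
    - K *ᵥ localCurrent V₀ ld (g.voltage x)
  out x := g.voltage x

end PIDGU

/-- A controlled DGU. -/
inductive ControlledDGU where
  | phs (g : PHSDGU)
  | pi (g : PIDGU)

namespace ControlledDGU

def Valid (ω₀ : ℝ) : ControlledDGU → Prop
  | phs g => g.Valid
  | pi g => g.Valid ω₀

def voltage : ControlledDGU → (DGUIx → ℝ) → (Fin 2 → ℝ)
  | phs g => g.voltage
  | pi g => g.voltage

def system (ω₀ V₀ : ℝ) (ld : Option StaticLoad) : ControlledDGU → OpenSystem DGUIx (Fin 2)
  | phs g => g.system ω₀ V₀ ld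
  | pi g => g.system ω₀ V₀ ld

/-- Matrix of the shifted quadratic Hamiltonian. -/
def energyMatrix : ControlledDGU → Matrix DGUIx DGUIx ℝ
  | phs g => g.Q
  | pi g => g.Pmat

/-- Shifted Hamiltonian (storage function). -/
def hamiltonian (g : ControlledDGU) (x xbar : DGUIx → ℝ) : ℝ :=
  (1 / 2) * ((x - xbar) ⬝ᵥ (g.energyMatrix *ᵥ (x - xbar)))

end ControlledDGU

/-! ### Load nodes and lines -/

/-- A lone-standing load node with node capacitance `C`; the state is `C V`. -/
structure LoadNode where
  C : ℝ
  load : StaticLoad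

namespace LoadNode

def voltage (b : LoadNode) (x : Fin 2 → ℝ) : Fin 2 → ℝ := fun a => x a / b.C

def system (b : LoadNode) (ω₀ V₀ : ℝ) : OpenSystem (Fin 2) (Fin 2) where
  dyn x d := ((ω₀ * b.C) • dqRot) *ᵥ b.voltage x - b.load.current V₀ (b.voltage x) + d
  out x := b.voltage x

/-- Shifted Hamiltonian. -/
def hamiltonian (b : LoadNode) (x xbar : Fin 2 → ℝ) : ℝ :=
  (1 / 2) * ((x - xbar) ⬝ᵥ ((1 / b.C) • (x - xbar)))

end LoadNode

/-- The series `RL` part of a `Π`-model line; the state is `L I`. -/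
structure RLLine where
  R : ℝ
  L : ℝ

namespace RLLine

def current (l : RLLine) (x : Fin 2 → ℝ) : Fin 2 → ℝ := fun a => x a / l.L

/-- Input: the voltages at both ends. Output: the current and its negative. -/
def system (l : RLLine) (ω₀ : ℝ) : OpenSystem (Fin 2) (Fin 2 ⊕ Fin 2) where
  dyn x d := ((ω₀ * l.L) • dqRot - l.R • 1) *ᵥ l.current x
    + (fromCols 1 (-1) : Matrix (Fin 2) (Fin 2 ⊕ Fin 2) ℝ) *ᵥ d
  out x := Sum.elim (l.current x) (-l.current x)

/-- Shifted Hamiltonian. -/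
def hamiltonian (l : RLLine) (x xbar : Fin 2 → ℝ) : ℝ :=
  (1 / 2) * ((x - xbar) ⬝ᵥ ((1 / l.L) • (x - xbar)))

end RLLine

/-! ### The microgrid -/

/-- An islanded microgrid with `D` controlled DGUs, `L` lone-standing loads and `P` lines of
arbitrary topology: line `l` is oriented from node `src l` to node `tgt l`. -/
structure Microgrid (D L P : ℕ) where
  ω₀ : ℝ
  V₀ : ℝ
  dgu : Fin D → ControlledDGU
  localLoad : Fin D → Option StaticLoad
  loadNode : Fin L → LoadNode
  line : Fin P → RLLine
  src : Fin P → Fin D ⊕ Fin L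
  tgt : Fin P → Fin D ⊕ Fin L

/-- Index set of the `2(3D + L + P)` composite states. -/
abbrev MGIx (D L P : ℕ) : Type := (Fin D × DGUIx) ⊕ (Fin L × Fin 2) ⊕ (Fin P × Fin 2)

/-- The state of DGU `i`. -/
def dguState {D L P : ℕ} (x : MGIx D L P → ℝ) (i : Fin D) : DGUIx → ℝ := fun a => x (.inl (i, a))

/-- The state of load node `j`. -/
def loadState {D L P : ℕ} (x : MGIx D L P → ℝ) (j : Fin L) : Fin 2 → ℝ :=
  fun a => x (.inr (.inl (j, a)))

/-- The state of line `l`. -/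
def lineState {D L P : ℕ} (x : MGIx D L P → ℝ) (l : Fin P) : Fin 2 → ℝ :=
  fun a => x (.inr (.inr (l, a)))

namespace Microgrid

variable {D L P : ℕ}

/-- Standing assumptions on the parameters. -/
structure Valid (mg : Microgrid D L P) : Prop where
  freq_pos : 0 < mg.ω₀
  nominal_pos : 0 < mg.V₀
  dgu_valid : ∀ i, (mg.dgu i).Valid mg.ω₀
  localLoad_nonneg : ∀ i, ∀ ld ∈ mg.localLoad i, ld.Nonneg
  capacitance_pos : ∀ j, 0 < (mg.loadNode j).C
  load_nonneg : ∀ j, (mg.loadNode j).load.Nonneg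
  resistance_pos : ∀ l, 0 < (mg.line l).R
  inductance_pos : ∀ l, 0 < (mg.line l).L

def dguSystem (mg : Microgrid D L P) (i : Fin D) : OpenSystem DGUIx (Fin 2) :=
  (mg.dgu i).system mg.ω₀ mg.V₀ (mg.localLoad i)

def loadSystem (mg : Microgrid D L P) (j : Fin L) : OpenSystem (Fin 2) (Fin 2) :=
  (mg.loadNode j).system mg.ω₀ mg.V₀

def lineSystem (mg : Microgrid D L P) (l : Fin P) : OpenSystem (Fin 2) (Fin 2 ⊕ Fin 2) :=
  (mg.line l).system mg.ω₀

/-- Coupling output (the voltage) of a DGU or load node. -/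
def nodeOutput (mg : Microgrid D L P) (x : MGIx D L P → ℝ) : Fin D ⊕ Fin L → (Fin 2 → ℝ)
  | .inl i => (mg.dguSystem i).out (dguState x i)
  | .inr j => (mg.loadSystem j).out (loadState x j)

/-- Coupling input of a DGU or load node: currents of incoming minus those of outgoing lines,
where a line's output is `(I, -I)` and its first half belongs to the source end. -/
def nodeInput (mg : Microgrid D L P) (x : MGIx D L P → ℝ) (k : Fin D ⊕ Fin L) : Fin 2 → ℝ :=
  -(∑ l with mg.src l = k, fun a => (mg.lineSystem l).out (lineState x l) (.inl a))
  + (∑ l with mg.tgt l = k, fun a => -(mg.lineSystem l).out (lineState x l) (.inr a))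

/-- Coupling input of a line: the voltages of its source and target node. -/
def lineInput (mg : Microgrid D L P) (x : MGIx D L P → ℝ) (l : Fin P) : Fin 2 ⊕ Fin 2 → ℝ :=
  Sum.elim (mg.nodeOutput x (mg.src l)) (mg.nodeOutput x (mg.tgt l))

/-- The vector field of the autonomous composite system. -/
def field (mg : Microgrid D L P) (x : MGIx D L P → ℝ) : MGIx D L P → ℝ
  | .inl (i, a) => (mg.dguSystem i).dyn (dguState x i) (mg.nodeInput x (.inl i)) a
  | .inr (.inl (j, a)) => (mg.loadSystem j).dyn (loadState x j) (mg.nodeInput x (.inr j)) a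
  | .inr (.inr (l, a)) => (mg.lineSystem l).dyn (lineState x l) (mg.lineInput x l) a

/-- The composite system, which has no open ports left. -/
def composite (mg : Microgrid D L P) : OpenSystem (MGIx D L P) (Fin 0) where
  dyn x _ := mg.field x
  out _ := 0

/-- Admissible states: the voltage at every load, local or lone-standing, is nonzero and satisfies
the passivity conditions of that load. -/
def admissible (mg : Microgrid D L P) : Set (MGIx D L P → ℝ) :=
  {x | (∀ i, ∀ ld ∈ mg.localLoad i, ld.Admissible mg.V₀ ((mg.dgu i).voltage (dguState x i))) ∧
    ∀ j, (mg.loadNode j).load.Admissible mg.V₀ ((mg.loadNode j).voltage (loadState x j))}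

/-- The sum of the shifted Hamiltonians of all subsystems. -/
def hamiltonian (mg : Microgrid D L P) (x xbar : MGIx D L P → ℝ) : ℝ :=
  (∑ i, (mg.dgu i).hamiltonian (dguState x i) (dguState xbar i))
  + (∑ j, (mg.loadNode j).hamiltonian (loadState x j) (loadState xbar j))
  + ∑ l, (mg.line l).hamiltonian (lineState x l) (lineState xbar l)

end Microgrid

end

/-!
# Stability of microgrids with equilibrium-independent passive components

**Passivity.** Every subsystem is affine in its state except for the load currents, so the shifted
Hamiltonian `H` obeys an exact energy balance about an equilibrium (`Microgrid.energy_balance`): the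
powers exchanged between nodes and lines cancel by Kirchhoff's laws (`power_balance`), and what
remains is the dissipation of the DGUs and of the line resistances, minus `ΔVᵀ ΔI` for each load.
Passivity therefore amounts to monotonicity of the load currents `I(V) = g(v) V + b(v) 𝕁 V` between
any two admissible voltages (`radialCurrent_monotone`). The admissible set is typically the exterior
of a disc, so integrating the Jacobian of `I` along a segment is not available. Minimising
`ΔVᵀ ΔI` over the angle between the two voltages instead leaves
`v² w² (b(v) - b(w))² ≤ (v² - w²) (g(v)² v² - g(w)² w²)`, which follows by a Cauchy–Schwarz argument
in the variable `-1/v²` from its infinitesimal form `(v b')² ≤ 4 g (v g' + g)`; for ZIP and EXP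
loads the latter is the passivity condition, and the amplitudes fulfilling it form an interval.

**Asymptotic stability.** `H` is not strict: it does not see undamped states of the DGUs. Instead of
an invariance argument, the proof makes it strict. The matrix `A` of each isolated DGU is Hurwitz (by
assumption, or by `PHSDGU.hurwitz`), so the Lyapunov equation `Aᵀ X + X A = -1` has a symmetric
solution (`exists_lyapunov_solution`). Adding `ε eᵀ X e / 2` for every DGU contributes `-ε |e|² / 4`
and cross terms in the line currents and in the local load currents. The former are dominated by the
line losses, the latter by `ΔVᵀ ΔI`, because near the equilibrium load currents are cocoercive
(`StaticLoad.exists_cocoercive`). For small `ε` the sum stays positive definite, whatever the sign of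
`X`, and decreases at a rate proportional to the squared distance, so that Lyapunov's direct method
(`isAsymptoticallyStable_of_lyapunov`) applies.
-/

/-! ### Asymptotic stability from a strict quadratic Lyapunov function -/

section Stability

variable {E : Type} [NormedAddCommGroup E] [NormedSpace ℝ E]

/-- A bounded, globally Lipschitz vector field has a solution on `[0, ∞)` through every point:
boundedness makes the Picard–Lindelöf theorem applicable on every `[0, n]`, and the solutions agree
by uniqueness. -/
theorem exists_isSolution_of_lipschitzWith_of_bounded [CompleteSpace E] {f : E → E} {K M : NNReal}
    (hf : LipschitzWith K f) (hM : ∀ x, ‖f x‖ ≤ M) (x₀ : E) :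
    ∃ γ, IsSolution f γ ∧ γ 0 = x₀ := by
  have hloc : ∀ n : ℕ, ∃ γ : ℝ → E, γ 0 = x₀ ∧
      ∀ t ∈ Set.Icc (0 : ℝ) n, HasDerivWithinAt γ (f (γ t)) (Set.Icc 0 n) t := by
    intro n
    have h0 : (0 : ℝ) ∈ Set.Icc (0 : ℝ) n := ⟨le_rfl, n.cast_nonneg⟩
    have hPL : IsPicardLindelof (fun _ : ℝ => f) (⟨0, h0⟩ : Set.Icc (0 : ℝ) n) x₀
        (M * n) 0 M K :=
      { lipschitzOnWith := fun _ _ => hf.lipschitzOnWith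
        continuousOn := fun _ _ => continuousOn_const
        norm_le := fun _ _ x _ => hM x
        mul_max_le := by simp }
    exact hPL.exists_eq_forall_mem_Icc_hasDerivWithinAt₀
  choose γ hγ0 hγ using hloc
  have hright : ∀ n : ℕ, ∀ t ∈ Set.Ico (0 : ℝ) n,
      HasDerivWithinAt (γ n) (f (γ n t)) (Set.Ici t) t := by
    intro n t ht
    refine (hγ n t ⟨ht.1, ht.2.le⟩).mono_of_mem_nhdsWithin ?_
    filter_upwards [Icc_mem_nhdsGE ht.2] with s hs using ⟨ht.1.trans hs.1, hs.2⟩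
  have hcont : ∀ n : ℕ, ContinuousOn (γ n) (Set.Icc 0 n) :=
    fun n t ht => (hγ n t ht).continuousWithinAt
  have hagree : ∀ m n : ℕ, m ≤ n → Set.EqOn (γ m) (γ n) (Set.Icc 0 m) := by
    intro m n hmn
    have hmn' : (m : ℝ) ≤ n := by exact_mod_cast hmn
    refine ODE_solution_unique (v := fun _ => f) (fun _ => hf) (hcont m) (hright m)
      ((hcont n).mono (Set.Icc_subset_Icc_right hmn'))
      (fun t ht => hright n t ⟨ht.1, ht.2.trans_le hmn'⟩) ?_
    rw [hγ0, hγ0]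
  have hcoe : ∀ m : ℕ, ∀ t ∈ Set.Ico (0 : ℝ) m, γ (⌊t⌋₊ + 1) t = γ m t := by
    intro m t ht
    have h1 : ⌊t⌋₊ + 1 ≤ m := Nat.succ_le_of_lt ((Nat.floor_lt ht.1).2 ht.2)
    exact hagree _ m h1 ⟨ht.1, by exact_mod_cast (Nat.lt_floor_add_one t).le⟩
  refine ⟨fun t => γ (⌊t⌋₊ + 1) t, fun t ht => ?_, by simpa using hγ0 1⟩
  obtain ⟨m, hm⟩ := exists_nat_gt t
  have htm : t ∈ Set.Ico (0 : ℝ) m := ⟨ht, hm⟩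
  have hd : HasDerivWithinAt (γ m) (f (γ m t)) (Set.Ici 0) t := by
    refine (hγ m t ⟨ht, hm.le⟩).mono_of_mem_nhdsWithin ?_
    filter_upwards [self_mem_nhdsWithin, mem_nhdsWithin_of_mem_nhds (Iic_mem_nhds hm)] with s h1 h2
      using ⟨h1, h2⟩
  have heq : (fun s => γ (⌊s⌋₊ + 1) s) =ᶠ[𝓝[Set.Ici 0] t] γ m := by
    filter_upwards [self_mem_nhdsWithin, mem_nhdsWithin_of_mem_nhds (Iio_mem_nhds hm)] with s h1 h2
      using hcoe m s ⟨h1, h2⟩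
  have := hd.congr_of_eventuallyEq heq (hcoe m t htm)
  simpa only [hcoe m t htm] using this

theorem IsSolution.continuousOn {f : E → E} {γ : ℝ → E} (h : IsSolution f γ) :
    ContinuousOn γ (Set.Ici 0) := fun t ht => (h t ht).continuousWithinAt

theorem IsSolution.hasDerivAt_comp {f : E → E} {γ : ℝ → E} (h : IsSolution f γ) {W : E → ℝ}
    (hW : Differentiable ℝ W) {t : ℝ} (ht : 0 < t) :
    HasDerivAt (fun s => W (γ s)) (fderiv ℝ W (γ t) (f (γ t))) t :=
  (hW (γ t)).hasFDerivAt.comp_hasDerivAt t ((h t ht.le).hasDerivAt (Ici_mem_nhds ht))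

/-- Trajectories cannot leave a ball on which the Lyapunov function is nonincreasing if they start
in a sublevel set contained in it. -/
theorem IsSolution.dist_lt_of_lyapunov {f : E → E} {γ : ℝ → E} (h : IsSolution f γ) {W : E → ℝ}
    (hW : Differentiable ℝ W) {xbar : E} {c₁ c₂ δ ε : ℝ} (hc₁ : 0 < c₁) (hc₂ : 0 < c₂) (hε : 0 < ε)
    (hlow : ∀ x, c₁ * dist x xbar ^ 2 ≤ W x) (hup : ∀ x, W x ≤ c₂ * dist x xbar ^ 2)
    (hdec : ∀ x, dist x xbar < ε → fderiv ℝ W x (f x) ≤ 0)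
    (hδε : c₂ * δ ^ 2 < c₁ * ε ^ 2) (h0 : dist (γ 0) xbar < δ) {t : ℝ} (ht : 0 ≤ t) :
    dist (γ t) xbar < ε := by
  by_contra! hcon
  have hW0 : W (γ 0) < c₁ * ε ^ 2 := by
    refine (hup _).trans_lt (lt_of_le_of_lt ?_ hδε)
    gcongr
  have hcd : ContinuousOn (fun s => dist (γ s) xbar) (Set.Icc 0 t) :=
    (continuous_id.dist continuous_const).comp_continuousOn
      (h.continuousOn.mono Set.Icc_subset_Ici_self)
  have hcpt : IsCompact (Set.Icc 0 t ∩ (fun s => dist (γ s) xbar) ⁻¹' Set.Ici ε) :=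
    isCompact_Icc.of_isClosed_subset (hcd.preimage_isClosed_of_isClosed isClosed_Icc isClosed_Ici)
      Set.inter_subset_left
  obtain ⟨τ, ⟨hτt, hτε⟩, hτmin⟩ := hcpt.exists_isLeast ⟨t, ⟨ht, le_rfl⟩, hcon⟩
  have hin : ∀ s ∈ Set.Ico 0 τ, dist (γ s) xbar < ε := by
    intro s hs
    by_contra! hs'
    exact absurd (hτmin ⟨⟨hs.1, hs.2.le.trans hτt.2⟩, hs'⟩) (not_le.2 hs.2)
  have hanti : AntitoneOn (fun s => W (γ s)) (Set.Icc 0 τ) := by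
    refine antitoneOn_of_hasDerivWithinAt_nonpos (convex_Icc 0 τ)
      (f' := fun s => fderiv ℝ W (γ s) (f (γ s))) ?_ ?_ ?_
    · exact hW.continuous.comp_continuousOn (h.continuousOn.mono Set.Icc_subset_Ici_self)
    · intro s hs
      rw [interior_Icc] at hs
      exact (h.hasDerivAt_comp hW hs.1).hasDerivWithinAt
    · intro s hs
      rw [interior_Icc] at hs
      exact hdec _ (hin s ⟨hs.1.le, hs.2⟩)
  have h1 : W (γ τ) ≤ W (γ 0) := hanti ⟨le_rfl, hτt.1⟩ ⟨hτt.1, le_rfl⟩ hτt.1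
  have h2 : c₁ * ε ^ 2 ≤ c₁ * dist (γ τ) xbar ^ 2 := by
    have : ε ≤ dist (γ τ) xbar := hτε
    gcongr
  linarith [hlow (γ τ)]

/-- Exponential decay of the Lyapunov function along trajectories in a region where it is
strict. -/
theorem IsSolution.tendsto_of_lyapunov {f : E → E} {γ : ℝ → E} (h : IsSolution f γ) {W : E → ℝ}
    (hW : Differentiable ℝ W) {xbar : E} {c₁ c₂ κ ε : ℝ} (hc₁ : 0 < c₁) (hc₂ : 0 < c₂) (hκ : 0 < κ)
    (hlow : ∀ x, c₁ * dist x xbar ^ 2 ≤ W x) (hup : ∀ x, W x ≤ c₂ * dist x xbar ^ 2)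
    (hdec : ∀ x, dist x xbar < ε → fderiv ℝ W x (f x) ≤ -κ * dist x xbar ^ 2)
    (hin : ∀ t, 0 ≤ t → dist (γ t) xbar < ε) : Tendsto γ atTop (𝓝 xbar) := by
  set a := κ / c₂ with ha
  have ha0 : 0 < a := div_pos hκ hc₂
  have hanti : AntitoneOn (fun s => Real.exp (a * s) * W (γ s)) (Set.Ici 0) := by
    refine antitoneOn_of_hasDerivWithinAt_nonpos (convex_Ici 0)
      (f' := fun s => Real.exp (a * s) * (a * 1) * W (γ s) +
        Real.exp (a * s) * fderiv ℝ W (γ s) (f (γ s))) ?_ ?_ ?_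
    · refine ContinuousOn.mul (by fun_prop) (hW.continuous.comp_continuousOn h.continuousOn)
    · intro s hs
      rw [interior_Ici] at hs
      exact ((((hasDerivAt_id s).const_mul a).exp).mul (h.hasDerivAt_comp hW hs)).hasDerivWithinAt
    · intro s hs
      rw [interior_Ici] at hs
      have h1 := hdec (γ s) (hin s (le_of_lt hs))
      have h2 : a * W (γ s) ≤ κ * dist (γ s) xbar ^ 2 := by
        calc a * W (γ s) ≤ a * (c₂ * dist (γ s) xbar ^ 2) := by gcongr; exact hup _
          _ = κ * dist (γ s) xbar ^ 2 := by rw [ha]; field_simp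
      have h3 := Real.exp_pos (a * s)
      have : Real.exp (a * s) * (a * W (γ s) + fderiv ℝ W (γ s) (f (γ s))) ≤ 0 :=
        mul_nonpos_of_nonneg_of_nonpos h3.le (by linarith)
      linarith
  have hbound : ∀ t, 0 ≤ t → dist (γ t) xbar ^ 2 ≤ W (γ 0) / c₁ * Real.exp (-(a * t)) := by
    intro t ht
    have h1 : Real.exp (a * t) * W (γ t) ≤ W (γ 0) := by
      simpa using hanti (Set.mem_Ici.2 le_rfl) (Set.mem_Ici.2 ht) ht
    have h3 := Real.exp_pos (a * t)
    rw [Real.exp_neg, div_mul_eq_mul_div, le_div_iff₀ hc₁, ← div_eq_mul_inv, le_div_iff₀ h3]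
    nlinarith [hlow (γ t)]
  have hlim : Tendsto (fun t => W (γ 0) / c₁ * Real.exp (-(a * t))) atTop (𝓝 0) := by
    have : Tendsto (fun t => Real.exp (-(a * t))) atTop (𝓝 0) :=
      Real.tendsto_exp_neg_atTop_nhds_zero.comp (tendsto_id.const_mul_atTop ha0)
    simpa using this.const_mul (W (γ 0) / c₁)
  have hsq : Tendsto (fun t => dist (γ t) xbar ^ 2) atTop (𝓝 0) :=
    squeeze_zero' (Eventually.of_forall fun t => sq_nonneg _)
      (by filter_upwards [eventually_ge_atTop 0] with t ht using hbound t ht) hlim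
  rw [tendsto_iff_dist_tendsto_zero]
  have := hsq.sqrt
  simpa [Real.sqrt_sq dist_nonneg] using this

end Stability

section FiniteDimensional

variable {ι : Type} [Fintype ι]

/-- Clamping coordinates to `[xbar i - r, xbar i + r]`, the nearest-point map to a closed ball of
the sup norm. -/
def clamp (xbar : ι → ℝ) (r : ℝ) (x : ι → ℝ) : ι → ℝ :=
  fun i => max (xbar i - r) (min (xbar i + r) (x i))

theorem lipschitzWith_clamp (xbar : ι → ℝ) (r : ℝ) : LipschitzWith 1 (clamp xbar r) := by
  refine LipschitzWith.of_dist_le_mul fun x y => ?_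
  rw [NNReal.coe_one, one_mul, dist_pi_le_iff dist_nonneg]
  intro i
  refine le_trans ?_ (dist_le_pi_dist x y i)
  simp only [clamp, Real.dist_eq]
  rw [max_comm (xbar i - r), max_comm (xbar i - r)]
  exact (abs_max_sub_max_le_abs _ _ _).trans
    (by simpa using abs_min_sub_min_le_max (xbar i + r) (x i) (xbar i + r) (y i))

theorem clamp_mem_closedBall (xbar : ι → ℝ) {r : ℝ} (hr : 0 ≤ r) (x : ι → ℝ) :
    clamp xbar r x ∈ Metric.closedBall xbar r := by
  rw [Metric.mem_closedBall, dist_pi_le_iff hr]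
  intro i
  rw [Real.dist_eq, abs_le, clamp]
  constructor
  · linarith [le_max_left (xbar i - r) (min (xbar i + r) (x i))]
  · have : max (xbar i - r) (min (xbar i + r) (x i)) ≤ xbar i + r :=
      max_le (by linarith) (min_le_left _ _)
    linarith

theorem clamp_of_mem_closedBall {xbar x : ι → ℝ} {r : ℝ} (hr : 0 ≤ r)
    (hx : x ∈ Metric.closedBall xbar r) : clamp xbar r x = x := by
  rw [Metric.mem_closedBall, dist_pi_le_iff hr] at hx
  funext i
  have := hx i
  rw [Real.dist_eq, abs_le] at this
  rw [clamp, min_eq_right (by linarith), max_eq_right (by linarith)]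

/-- **Lyapunov's direct method** for a strict Lyapunov function that is comparable to the squared
distance. Solutions on `[0, ∞)` are obtained for the field composed with the clamping map, which is
bounded and globally Lipschitz; they never leave the ball where both fields agree. -/
theorem isAsymptoticallyStable_of_lyapunov {f : (ι → ℝ) → (ι → ℝ)} {xbar : ι → ℝ}
    (hf0 : f xbar = 0) (hf : ContDiffAt ℝ 1 f xbar) {W : (ι → ℝ) → ℝ} (hW : Differentiable ℝ W)
    {c₁ c₂ κ : ℝ} (hc₁ : 0 < c₁) (hc₂ : 0 < c₂) (hκ : 0 < κ)
    (hlow : ∀ x, c₁ * dist x xbar ^ 2 ≤ W x) (hup : ∀ x, W x ≤ c₂ * dist x xbar ^ 2)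
    (hdec : ∀ᶠ x in 𝓝 xbar, fderiv ℝ W x (f x) ≤ -κ * dist x xbar ^ 2) :
    IsAsymptoticallyStable f xbar := by
  obtain ⟨K, s, hs, hK⟩ := hf.exists_lipschitzOnWith
  obtain ⟨r, hr, hball⟩ := Metric.nhds_basis_closedBall.eventually_iff.1 (hdec.and hs)
  have hdec' : ∀ x ∈ Metric.closedBall xbar r, fderiv ℝ W x (f x) ≤ -κ * dist x xbar ^ 2 :=
    fun x hx => (hball hx).1
  have hnonpos : ∀ x, -κ * dist x xbar ^ 2 ≤ 0 := fun x => by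
    nlinarith [sq_nonneg (dist x xbar)]
  have hradius : ∀ ε > 0, ∃ δ > 0, c₂ * δ ^ 2 < c₁ * ε ^ 2 := by
    intro ε hε
    refine ⟨√(c₁ / (2 * c₂)) * ε, by positivity, ?_⟩
    rw [mul_pow, Real.sq_sqrt (by positivity)]
    have : c₂ * (c₁ / (2 * c₂) * ε ^ 2) = c₁ * ε ^ 2 / 2 := by field_simp
    rw [this]
    have : 0 < c₁ * ε ^ 2 := by positivity
    linarith
  obtain ⟨δ, hδ, hδr⟩ := hradius r hr
  refine ⟨hf0, ⟨δ, hδ, fun x₀ hx₀ => ?_⟩, fun ε hε => ?_, δ, hδ, fun γ hγ hγ0 => ?_⟩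
  · have hlip : LipschitzWith (K * 1) (fun x => f (clamp xbar r x)) := by
      rw [← lipschitzOnWith_univ]
      exact hK.comp (lipschitzWith_clamp xbar r).lipschitzOnWith
        fun x _ => (hball (clamp_mem_closedBall xbar hr.le x)).2
    have hbdd : ∀ x, ‖f (clamp xbar r x)‖ ≤ (K * r.toNNReal : NNReal) := by
      intro x
      have hx := clamp_mem_closedBall xbar hr.le x
      have h1 := hK.dist_le_mul _ (hball hx).2 _ (mem_of_mem_nhds hs)
      rw [hf0, dist_zero_right] at h1
      rw [NNReal.coe_mul, Real.coe_toNNReal r hr.le]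
      refine h1.trans ?_
      gcongr
      exact hx
    obtain ⟨γ, hγ, hγ0⟩ := exists_isSolution_of_lipschitzWith_of_bounded hlip hbdd x₀
    refine ⟨γ, fun t ht => ?_, hγ0⟩
    have hin : dist (γ t) xbar < r := by
      refine hγ.dist_lt_of_lyapunov hW hc₁ hc₂ hr hlow hup (fun x hx => ?_) hδr (by rwa [hγ0]) ht
      have hx' : x ∈ Metric.closedBall xbar r := Metric.mem_closedBall.2 hx.le
      rw [clamp_of_mem_closedBall hr.le hx']
      exact (hdec' x hx').trans (hnonpos x)
    have := hγ t ht
    beta_reduce at this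
    rwa [clamp_of_mem_closedBall hr.le (Metric.mem_closedBall.2 hin.le)] at this
  · obtain ⟨δ', hδ', hδε⟩ := hradius (min ε r) (lt_min hε hr)
    refine ⟨δ', hδ', fun γ hγ hγ0 t ht => lt_of_lt_of_le ?_ (min_le_left ε r)⟩
    refine hγ.dist_lt_of_lyapunov hW hc₁ hc₂ (lt_min hε hr) hlow hup (fun x hx => ?_) hδε hγ0 ht
    exact (hdec' x (Metric.mem_closedBall.2 (hx.le.trans (min_le_right ε r)))).trans (hnonpos x)
  · refine hγ.tendsto_of_lyapunov hW hc₁ hc₂ hκ hlow hup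
      (fun x hx => hdec' x (Metric.mem_closedBall.2 (le_of_lt hx))) (ε := r) fun t ht => ?_
    exact hγ.dist_lt_of_lyapunov hW hc₁ hc₂ hr hlow hup
      (fun x hx => (hdec' x (Metric.mem_closedBall.2 hx.le)).trans (hnonpos x)) hδr hγ0 ht

end FiniteDimensional

/-! ### Quadratic forms and the Lyapunov equation -/

section QuadraticForms

variable {m n : Type} [Fintype m] [Fintype n]

theorem dotProduct_self_nonneg_real (v : n → ℝ) : 0 ≤ v ⬝ᵥ v :=
  Finset.sum_nonneg fun i _ => mul_self_nonneg (v i)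

theorem exists_mulVec_dotProduct_self_le (M : Matrix m n ℝ) :
    ∃ B > 0, ∀ v, (M *ᵥ v) ⬝ᵥ (M *ᵥ v) ≤ B * (v ⬝ᵥ v) := by
  refine ⟨∑ i, ∑ j, M i j ^ 2 + 1, by positivity, fun v => ?_⟩
  have h : (M *ᵥ v) ⬝ᵥ (M *ᵥ v) ≤ (∑ i, ∑ j, M i j ^ 2) * (v ⬝ᵥ v) := by
    rw [dotProduct, Finset.sum_mul]
    refine Finset.sum_le_sum fun i _ => ?_
    have := Finset.sum_mul_sq_le_sq_mul_sq Finset.univ (M i) v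
    simpa only [mulVec, dotProduct, ← sq] using this
  linarith [dotProduct_self_nonneg_real v]

theorem two_mul_dotProduct_le (u v : n → ℝ) {t : ℝ} (ht : 0 < t) :
    2 * (u ⬝ᵥ v) ≤ t * (u ⬝ᵥ u) + t⁻¹ * (v ⬝ᵥ v) := by
  simp only [dotProduct, Finset.mul_sum, ← Finset.sum_add_distrib]
  refine Finset.sum_le_sum fun i _ => ?_
  have h : 0 ≤ t⁻¹ * (t * u i - v i) ^ 2 := by positivity
  have h2 : t⁻¹ * (t * u i - v i) ^ 2 = t * (u i * u i) + t⁻¹ * (v i * v i) - 2 * (u i * v i) := by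
    field_simp
    ring
  linarith

theorem exists_abs_quadratic_le (M : Matrix n n ℝ) :
    ∃ B > 0, ∀ v, |v ⬝ᵥ (M *ᵥ v)| ≤ B * (v ⬝ᵥ v) := by
  obtain ⟨B, hB, h⟩ := exists_mulVec_dotProduct_self_le M
  refine ⟨1 + B, by positivity, fun v => ?_⟩
  have h1 := two_mul_dotProduct_le v (M *ᵥ v) one_pos
  have h2 := two_mul_dotProduct_le v (-(M *ᵥ v)) one_pos
  simp only [dotProduct_neg, neg_dotProduct] at h2
  have h3 := dotProduct_self_nonneg_real v
  rw [abs_le]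
  constructor <;> nlinarith [h v]

theorem Matrix.PosDef.exists_mul_le_quadratic {M : Matrix n n ℝ} (hM : M.PosDef) :
    ∃ c > 0, ∀ v, c * (v ⬝ᵥ v) ≤ v ⬝ᵥ (M *ᵥ v) := by
  classical
  obtain ⟨y, hy⟩ : ∃ y : Matrix n n ℝ, M = yᵀ * y := by
    open scoped MatrixOrder in
    exact CStarAlgebra.nonneg_iff_eq_star_mul_self.mp hM.posSemidef.nonneg
  have hdet : IsUnit y.det := by
    have h := (isUnit_iff_isUnit_det _).1 hM.isUnit
    rw [hy, det_mul] at h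
    exact isUnit_of_mul_isUnit_right h
  obtain ⟨B, hB, h⟩ := exists_mulVec_dotProduct_self_le y⁻¹
  refine ⟨B⁻¹, by positivity, fun v => ?_⟩
  have h1 := h (y *ᵥ v)
  rw [mulVec_mulVec, nonsing_inv_mul _ hdet, one_mulVec] at h1
  rw [inv_mul_le_iff₀ hB, hy, ← mulVec_mulVec, dotProduct_mulVec, vecMul_transpose]
  exact h1

/-- The derivative of a quadratic form with a symmetric matrix. -/
theorem hasFDerivAt_quadratic {E : Type} [NormedAddCommGroup E] [NormedSpace ℝ E]
    {M : Matrix n n ℝ} (hM : Mᵀ = M) (T : E →L[ℝ] (n → ℝ)) (x xbar : E) :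
    ∃ f' : E →L[ℝ] ℝ,
      HasFDerivAt (fun y => (1 / 2 : ℝ) * ((T y - T xbar) ⬝ᵥ (M *ᵥ (T y - T xbar)))) f' x ∧
      ∀ v, f' v = (T x - T xbar) ⬝ᵥ (M *ᵥ T v) := by
  have hT : ∀ i, HasFDerivAt (fun y => (T y - T xbar) i)
      ((ContinuousLinearMap.proj i : (n → ℝ) →L[ℝ] ℝ).comp T) x := fun i =>
    (((ContinuousLinearMap.proj i : (n → ℝ) →L[ℝ] ℝ).comp T).hasFDerivAt).sub_const _
  have h := (HasFDerivAt.fun_sum (u := Finset.univ) fun i _ =>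
    (hT i).mul (HasFDerivAt.fun_sum (u := Finset.univ) fun j _ =>
      (hT j).const_mul (M i j))).const_mul (1 / 2 : ℝ)
  refine ⟨_, h, fun v => ?_⟩
  have hsymm : ∀ a b : n → ℝ, a ⬝ᵥ (M *ᵥ b) = b ⬝ᵥ (M *ᵥ a) := fun a b => by
    conv_rhs => rw [← hM]
    rw [mulVec_transpose, dotProduct_comm b, dotProduct_mulVec]
  have h2 : (1 / 2 : ℝ) * ((T x - T xbar) ⬝ᵥ (M *ᵥ T v) + T v ⬝ᵥ (M *ᵥ (T x - T xbar))) =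
      (T x - T xbar) ⬝ᵥ (M *ᵥ T v) := by
    rw [hsymm (T v)]
    ring
  rw [← h2]
  simp only [_root_.smul_apply, _root_.sum_apply, _root_.add_apply,
    ContinuousLinearMap.comp_apply, ContinuousLinearMap.proj_apply, smul_eq_mul, dotProduct, mulVec,
    Finset.sum_add_distrib]
  simp only [mul_comm (T v _)]

end QuadraticForms

section LyapunovEquation

variable {n : Type} [Fintype n] [DecidableEq n]

/-- A nonzero matrix of left eigenvectors exhibits an eigenvalue. -/
theorem neg_mem_spectrum_of_mul_eq {B Y : Matrix n n ℂ} {μ : ℂ} (hY : Y ≠ 0)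
    (h : Y * B = -μ • Y) : -μ ∈ spectrum ℂ B := by
  rw [spectrum.mem_iff]
  intro hu
  apply hY
  have h0 : Y * (algebraMap ℂ (Matrix n n ℂ) (-μ) - B) = 0 := by
    rw [mul_sub, h, Algebra.algebraMap_eq_smul_one, mul_smul_comm, mul_one, sub_self]
  exact hu.mul_left_eq_zero.1 h0

/-- If the spectrum of `B` lies in the open left half plane, `Bᵀ Y + Y B = 0` has only the trivial
solution: an eigenvector, for eigenvalue `μ`, of left multiplication by `Bᵀ` on the solution space
exhibits both `μ` and `-μ` as eigenvalues of `B`. -/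
theorem eq_zero_of_lyapunov_eq_zero {B : Matrix n n ℂ} (hB : ∀ μ ∈ spectrum ℂ B, μ.re < 0)
    {Y : Matrix n n ℂ} (hY : Bᵀ * Y + Y * B = 0) : Y = 0 := by
  by_contra hne
  let S : Submodule ℂ (Matrix n n ℂ) :=
    LinearMap.ker (LinearMap.mulLeft ℂ Bᵀ + LinearMap.mulRight ℂ B)
  have hS : ∀ Z, Z ∈ S ↔ Bᵀ * Z + Z * B = 0 := fun Z => by simp [S, LinearMap.mem_ker]
  have hinv : ∀ Z ∈ S, LinearMap.mulLeft ℂ Bᵀ Z ∈ S := fun Z hZ => by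
    rw [hS] at hZ ⊢
    rw [LinearMap.mulLeft_apply, mul_assoc Bᵀ Z B, ← mul_add, hZ, mul_zero]
  have : Nontrivial S := ⟨⟨⟨Y, (hS Y).2 hY⟩, 0, fun h => hne (congrArg Subtype.val h)⟩⟩
  obtain ⟨μ, hμ⟩ := Module.End.exists_eigenvalue ((LinearMap.mulLeft ℂ Bᵀ).restrict hinv)
  obtain ⟨⟨Z, hZS⟩, hZ⟩ := hμ.exists_hasEigenvector
  have hZ0 : Z ≠ 0 := fun h => hZ.2 (Subtype.ext h)
  have hZμ : Bᵀ * Z = μ • Z := congrArg Subtype.val hZ.apply_eq_smul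
  have hZB : Z * B = -μ • Z := by
    rw [hS, hZμ] at hZS
    rw [neg_smul]
    exact eq_neg_of_add_eq_zero_right hZS
  have h1 := hB _ (neg_mem_spectrum_of_mul_eq hZ0 hZB)
  have h2 : μ ∈ spectrum ℂ B := by
    have hZt : Zᵀ * B = -(-μ) • Zᵀ := by
      rw [neg_neg, ← transpose_smul, ← hZμ, transpose_mul, transpose_transpose]
    simpa using neg_mem_spectrum_of_mul_eq (fun h => hZ0 (transpose_eq_zero.1 h)) hZt
  have h3 := hB _ h2
  rw [Complex.neg_re] at h1
  linarith

/-- A Hurwitz matrix admits a symmetric solution of the Lyapunov equation with right-hand side `-1`.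
(Positivity of the solution is not needed below.) -/
theorem exists_lyapunov_solution {A : Matrix n n ℝ}
    (hA : ∀ μ ∈ spectrum ℂ (A.map (algebraMap ℝ ℂ)), μ.re < 0) :
    ∃ X : Matrix n n ℝ, Xᵀ = X ∧ Aᵀ * X + X * A = -1 := by
  let T : Matrix n n ℝ →ₗ[ℝ] Matrix n n ℝ := LinearMap.mulLeft ℝ Aᵀ + LinearMap.mulRight ℝ A
  have hT : ∀ X, T X = Aᵀ * X + X * A := fun X => by simp [T]
  have hinj : Function.Injective T := by
    rw [← LinearMap.ker_eq_bot, LinearMap.ker_eq_bot']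
    intro X hX
    rw [hT] at hX
    have h := congrArg (fun M : Matrix n n ℝ => M.map (algebraMap ℝ ℂ)) hX
    have h0 : X.map (algebraMap ℝ ℂ) = 0 := by
      refine eq_zero_of_lyapunov_eq_zero hA ?_
      simp only [Matrix.map_add _ (map_add (algebraMap ℝ ℂ)), Matrix.map_mul,
        Matrix.map_zero _ (map_zero (algebraMap ℝ ℂ))] at h
      exact h
    ext i j
    have := congrFun (congrFun h0 i) j
    simpa using this
  obtain ⟨X, hX⟩ := (LinearMap.injective_iff_surjective.1 hinj) (-1)
  rw [hT] at hX
  refine ⟨(1 / 2 : ℝ) • (X + Xᵀ), by rw [transpose_smul, transpose_add, transpose_transpose,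
    add_comm], ?_⟩
  have hXt : Aᵀ * Xᵀ + Xᵀ * A = -1 := by
    have := congrArg transpose hX
    simp only [transpose_add, transpose_mul, transpose_transpose, transpose_neg,
      transpose_one] at this
    rw [add_comm]
    exact this
  calc Aᵀ * ((1 / 2 : ℝ) • (X + Xᵀ)) + ((1 / 2 : ℝ) • (X + Xᵀ)) * A
      = (1 / 2 : ℝ) • ((Aᵀ * X + X * A) + (Aᵀ * Xᵀ + Xᵀ * A)) := by
        rw [mul_smul_comm, smul_mul_assoc, mul_add, add_mul, ← smul_add]
        congr 1
        abel
    _ = -1 := by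
        rw [hX, hXt, ← two_smul ℝ (-1 : Matrix n n ℝ), smul_smul]
        norm_num

/-- A complex eigenvalue of a real matrix, seen through the real and imaginary part of an
eigenvector. -/
theorem exists_real_eigenplane {A : Matrix n n ℝ} {μ : ℂ}
    (h : μ ∈ spectrum ℂ (A.map (algebraMap ℝ ℂ))) :
    ∃ p q : n → ℝ, (p ≠ 0 ∨ q ≠ 0) ∧
      A *ᵥ p = μ.re • p - μ.im • q ∧ A *ᵥ q = μ.im • p + μ.re • q := by
  rw [← spectrum_toLin', ← Module.End.hasEigenvalue_iff_mem_spectrum] at h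
  obtain ⟨v, hv⟩ := h.exists_hasEigenvector
  have hAv : ∀ i, ∑ j, (A i j : ℂ) * v j = μ * v i := fun i =>
    congrFun (hv.apply_eq_smul : _ = μ • v) i
  refine ⟨fun i => (v i).re, fun i => (v i).im, ?_, ?_, ?_⟩
  · by_contra! h0
    exact hv.2 (funext fun i => Complex.ext (congrFun h0.1 i) (congrFun h0.2 i))
  · funext i
    simpa [mulVec, dotProduct] using congrArg Complex.re (hAv i)
  · funext i
    simpa [mulVec, dotProduct, add_comm] using congrArg Complex.im (hAv i)

end LyapunovEquation

/-! ### Monotonicity of static load currents -/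

section RadialCurrents

theorem norm_sq_le_dotProduct_self {n : Type} [Fintype n] (v : n → ℝ) : ‖v‖ ^ 2 ≤ v ⬝ᵥ v := by
  have h0 := dotProduct_self_nonneg_real v
  refine (Real.le_sqrt (norm_nonneg v) h0).1 ((pi_norm_le_iff_of_nonneg (Real.sqrt_nonneg _)).2
    fun i => ?_)
  rw [Real.norm_eq_abs]
  refine Real.abs_le_sqrt ?_
  rw [sq]
  exact Finset.single_le_sum (f := fun i => v i * v i) (fun j _ => mul_self_nonneg (v j))
    (Finset.mem_univ i)

theorem dotProduct_self_le_card_mul_norm_sq {n : Type} [Fintype n] (v : n → ℝ) :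
    v ⬝ᵥ v ≤ Fintype.card n * ‖v‖ ^ 2 := by
  have h : ∀ i ∈ Finset.univ, v i * v i ≤ ‖v‖ ^ 2 := fun i _ => by
    rw [← sq, ← sq_abs, ← Real.norm_eq_abs]
    gcongr
    exact norm_le_pi_norm v i
  simpa [dotProduct] using Finset.sum_le_card_nsmul _ _ _ h

theorem dqAmplitude_sq (V : Fin 2 → ℝ) : dqAmplitude V ^ 2 = V 0 ^ 2 + V 1 ^ 2 :=
  Real.sq_sqrt (by positivity)

theorem sq_add_sq_pos {V : Fin 2 → ℝ} (hV : V ≠ 0) : 0 < V 0 ^ 2 + V 1 ^ 2 := by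
  by_contra! h
  refine hV (funext fun i => ?_)
  fin_cases i
  · simpa using (by nlinarith [sq_nonneg (V 0), sq_nonneg (V 1)] : V 0 ^ 2 = 0)
  · simpa using (by nlinarith [sq_nonneg (V 0), sq_nonneg (V 1)] : V 1 ^ 2 = 0)

theorem dqAmplitude_pos {V : Fin 2 → ℝ} (hV : V ≠ 0) : 0 < dqAmplitude V :=
  Real.sqrt_pos.2 (sq_add_sq_pos hV)

theorem contDiffAt_dqAmplitude {V : Fin 2 → ℝ} (hV : V ≠ 0) : ContDiffAt ℝ 1 dqAmplitude V := by
  unfold dqAmplitude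
  exact ContDiffAt.sqrt (by fun_prop) (sq_add_sq_pos hV).ne'

/-- The current `g(v) V + b(v) 𝕁 V` of a load with amplitude-dependent conductance `g` and
susceptance `b`. -/
noncomputable def radialCurrent (g b : ℝ → ℝ) (V : Fin 2 → ℝ) : Fin 2 → ℝ :=
  ![g (dqAmplitude V) * V 0 + b (dqAmplitude V) * V 1,
    g (dqAmplitude V) * V 1 - b (dqAmplitude V) * V 0]

theorem contDiffAt_radialCurrent {g b : ℝ → ℝ} {V : Fin 2 → ℝ} (hV : V ≠ 0)
    (hg : ContDiffAt ℝ 1 g (dqAmplitude V)) (hb : ContDiffAt ℝ 1 b (dqAmplitude V)) :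
    ContDiffAt ℝ 1 (radialCurrent g b) V := by
  have h := contDiffAt_dqAmplitude hV
  have hg' : ContDiffAt ℝ 1 (fun V => g (dqAmplitude V)) V := hg.comp V h
  have hb' : ContDiffAt ℝ 1 (fun V => b (dqAmplitude V)) V := hb.comp V h
  rw [contDiffAt_pi]
  intro i
  fin_cases i
  · show ContDiffAt ℝ 1 (fun V => g (dqAmplitude V) * V 0 + b (dqAmplitude V) * V 1) V
    fun_prop
  · show ContDiffAt ℝ 1 (fun V => g (dqAmplitude V) * V 1 - b (dqAmplitude V) * V 0) V
    fun_prop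

/-- The integrated form of the pointwise inequality `(v b')² ≤ 4 g (v g' + g)`. In the variable
`s = -1/v²` it says `(db/ds)² ≤ d(g² v²)/ds`, so that for every `c` the function
`g² v² - 2 c b + c² s` is monotone; the claim is the discriminant condition in `c`. -/
theorem sq_susceptance_sub_le {g b g' b' : ℝ → ℝ} {w v : ℝ} (hw : 0 < w) (hwv : w ≤ v)
    (hg : ∀ u ∈ Set.Icc w v, HasDerivAt g (g' u) u) (hb : ∀ u ∈ Set.Icc w v, HasDerivAt b (b' u) u)
    (h : ∀ u ∈ Set.Icc w v, b' u ^ 2 * u ^ 2 ≤ 4 * g u * (g' u * u + g u)) :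
    v ^ 2 * w ^ 2 * (b v - b w) ^ 2 ≤
      (v ^ 2 - w ^ 2) * (g v ^ 2 * v ^ 2 - g w ^ 2 * w ^ 2) := by
  rcases hwv.eq_or_lt with rfl | hlt
  · simp
  have hv : 0 < v := hw.trans hlt
  have hmono : ∀ c : ℝ, MonotoneOn
      (fun u => (g u * u) ^ 2 - 2 * c * b u - c ^ 2 * (u ^ 2)⁻¹) (Set.Icc w v) := by
    intro c
    have hder : ∀ u ∈ Set.Icc w v, HasDerivAt
        (fun u => (g u * u) ^ 2 - 2 * c * b u - c ^ 2 * (u ^ 2)⁻¹)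
        (2 * (g u * u) * (g' u * u + g u) - 2 * c * b' u + 2 * c ^ 2 / u ^ 3) u := by
      intro u hu
      have hu0 : u ≠ 0 := (hw.trans_le hu.1).ne'
      have h1 := (((hg u hu).mul (hasDerivAt_id u)).pow 2).sub ((hb u hu).const_mul (2 * c))
      have h2 := ((((hasDerivAt_id u).pow 2).inv (pow_ne_zero 2 hu0)).const_mul (c ^ 2))
      refine (h1.sub h2).congr_deriv ?_
      simp only [Pi.mul_apply, Pi.pow_apply, id]
      field_simp
      ring
    refine monotoneOn_of_hasDerivWithinAt_nonneg (convex_Icc w v)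
      (f' := fun u => 2 * (g u * u) * (g' u * u + g u) - 2 * c * b' u + 2 * c ^ 2 / u ^ 3)
      (fun u hu => (hder u hu).continuousAt.continuousWithinAt)
      (fun u hu => (hder u (interior_subset hu)).hasDerivWithinAt) ?_
    intro u hu
    have hu' := interior_subset hu
    have hu0 : 0 < u := hw.trans_le hu'.1
    have h3 : 0 ≤ (b' u * u ^ 3 - 2 * c) ^ 2 / (2 * u ^ 3) := by positivity
    have h4 : (b' u * u ^ 3 - 2 * c) ^ 2 / (2 * u ^ 3) =
        u / 2 * (b' u ^ 2 * u ^ 2) - 2 * c * b' u + 2 * c ^ 2 / u ^ 3 := by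
      field_simp
      ring
    have h5 : u / 2 * (b' u ^ 2 * u ^ 2) ≤ u / 2 * (4 * g u * (g' u * u + g u)) :=
      mul_le_mul_of_nonneg_left (h u hu') (by positivity)
    linarith
  set σ := (w ^ 2)⁻¹ - (v ^ 2)⁻¹ with hσ
  have hσ' : σ = (v ^ 2 - w ^ 2) / (v ^ 2 * w ^ 2) := by
    rw [hσ]
    field_simp
  have hsq : 0 < v ^ 2 - w ^ 2 := by nlinarith
  have hσ0 : 0 < σ := by rw [hσ']; positivity
  have hc := hmono ((b v - b w) / σ) ⟨le_rfl, hwv⟩ ⟨hwv, le_rfl⟩ hwv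
  have h6 : (b v - b w) ^ 2 / σ ≤ (g v * v) ^ 2 - (g w * w) ^ 2 := by
    have h7 : (b v - b w) ^ 2 / σ = 2 * ((b v - b w) / σ) * (b v - b w)
        - ((b v - b w) / σ) ^ 2 * σ := by
      field_simp
      ring
    rw [h7]
    simp only at hc
    have : ((b v - b w) / σ) ^ 2 * σ = ((b v - b w) / σ) ^ 2 * (w ^ 2)⁻¹
        - ((b v - b w) / σ) ^ 2 * (v ^ 2)⁻¹ := by rw [hσ]; ring
    linarith
  rw [div_le_iff₀ hσ0, hσ', ← mul_div_assoc, le_div_iff₀ (by positivity)] at h6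
  linarith

/-- Monotonicity of a radial current between any two voltages whose amplitudes lie in an interval on
which `g ≥ 0` and `(v b')² ≤ 4 g (v g' + g)`. The two voltages need not be joined by a segment of
admissible voltages: minimising over the angle between them leaves the scalar inequality
`sq_susceptance_sub_le` between the two amplitudes. -/
theorem radialCurrent_monotone {g b g' b' : ℝ → ℝ} {s : Set ℝ} [hs : s.OrdConnected]
    (hs0 : ∀ u ∈ s, 0 < u)
    (hg : ∀ u ∈ s, HasDerivAt g (g' u) u) (hb : ∀ u ∈ s, HasDerivAt b (b' u) u)
    (hg0 : ∀ u ∈ s, 0 ≤ g u)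
    (h : ∀ u ∈ s, b' u ^ 2 * u ^ 2 ≤ 4 * g u * (g' u * u + g u)) {V W : Fin 2 → ℝ}
    (hV : dqAmplitude V ∈ s) (hW : dqAmplitude W ∈ s) :
    0 ≤ (V - W) ⬝ᵥ (radialCurrent g b V - radialCurrent g b W) := by
  have hscal : ∀ v ∈ s, ∀ w ∈ s, w ≤ v → v ^ 2 * w ^ 2 * (b v - b w) ^ 2 ≤
      (v ^ 2 - w ^ 2) * (g v ^ 2 * v ^ 2 - g w ^ 2 * w ^ 2) := fun v hv w hw hwv => by
    have hsub := hs.out hw hv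
    exact sq_susceptance_sub_le (hs0 w hw) hwv (fun u hu => hg u (hsub hu))
      (fun u hu => hb u (hsub hu)) fun u hu => h u (hsub hu)
  have hkey : dqAmplitude V ^ 2 * dqAmplitude W ^ 2 * (b (dqAmplitude V) - b (dqAmplitude W)) ^ 2 ≤
      (dqAmplitude V ^ 2 - dqAmplitude W ^ 2) * (g (dqAmplitude V) ^ 2 * dqAmplitude V ^ 2
        - g (dqAmplitude W) ^ 2 * dqAmplitude W ^ 2) := by
    rcases le_total (dqAmplitude W) (dqAmplitude V) with hle | hle
    · exact hscal _ hV _ hW hle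
    · linarith [hscal _ hW _ hV hle]
  have hgv := hg0 _ hV
  have hgw := hg0 _ hW
  have hv2 := dqAmplitude_sq V
  have hw2 := dqAmplitude_sq W
  set v := dqAmplitude V with hv
  set w := dqAmplitude W with hw
  set G := g v
  set G₁ := g w
  set B := b v
  set B₁ := b w
  have hexp : (V - W) ⬝ᵥ (radialCurrent g b V - radialCurrent g b W) =
      (G * v ^ 2 + G₁ * w ^ 2)
        - ((G + G₁) * (V 0 * W 0 + V 1 * W 1) + (B - B₁) * (W 0 * V 1 - W 1 * V 0)) := by
    rw [hv2, hw2]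
    simp only [radialCurrent, ← hv, ← hw, dotProduct, Fin.sum_univ_two, Pi.sub_apply,
      Matrix.cons_val_zero, Matrix.cons_val_one]
    ring
  rw [hexp, sub_nonneg]
  refine le_trans (le_abs_self _) (abs_le_of_sq_le_sq ?_ (by positivity))
  -- Cauchy–Schwarz in the plane, as `(V ⬝ W)² + (V × W)² = v² w²`.
  have hcs : ((G + G₁) * (V 0 * W 0 + V 1 * W 1) + (B - B₁) * (W 0 * V 1 - W 1 * V 0)) ^ 2 ≤
      ((G + G₁) ^ 2 + (B - B₁) ^ 2) * (v ^ 2 * w ^ 2) := by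
    rw [hv2, hw2]
    nlinarith [sq_nonneg ((G + G₁) * (W 0 * V 1 - W 1 * V 0)
      - (B - B₁) * (V 0 * W 0 + V 1 * W 1))]
  refine hcs.trans ?_
  nlinarith [hkey]

end RadialCurrents

namespace StaticLoad

/-- Conductance as a function of the voltage amplitude. -/
noncomputable def conductance (V₀ : ℝ) : StaticLoad → ℝ → ℝ
  | zip Yp Ip Pp _ _ _, v => Pp / v ^ 2 + Ip / v + Yp
  | exp P0 _ np _, v => P0 * v ^ (np - 2) / V₀ ^ np

/-- Susceptance as a function of the voltage amplitude. -/
noncomputable def susceptance (V₀ : ℝ) : StaticLoad → ℝ → ℝ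
  | zip _ _ _ Yq Iq Pq, v => Pq / v ^ 2 + Iq / v + Yq
  | exp _ Q0 _ nq, v => Q0 * v ^ (nq - 2) / V₀ ^ nq

/-- Derivative of the conductance. -/
noncomputable def conductanceDeriv (V₀ : ℝ) : StaticLoad → ℝ → ℝ
  | zip _ Ip Pp _ _ _, v => -(2 * Pp / v ^ 3) - Ip / v ^ 2
  | exp P0 _ np _, v => P0 * ((np - 2) * v ^ (np - 2 - 1)) / V₀ ^ np

/-- Derivative of the susceptance. -/
noncomputable def susceptanceDeriv (V₀ : ℝ) : StaticLoad → ℝ → ℝ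
  | zip _ _ _ _ Iq Pq, v => -(2 * Pq / v ^ 3) - Iq / v ^ 2
  | exp _ Q0 _ nq, v => Q0 * ((nq - 2) * v ^ (nq - 2 - 1)) / V₀ ^ nq

theorem current_eq_radialCurrent (V₀ : ℝ) (ld : StaticLoad) (V : Fin 2 → ℝ) :
    ld.current V₀ V = radialCurrent (ld.conductance V₀) (ld.susceptance V₀) V := by
  cases ld <;> funext i <;> fin_cases i <;>
    simp [current, radialCurrent, conductance, susceptance] <;> ring

theorem hasDerivAt_zip_aux (a₂ a₁ a₀ : ℝ) {v : ℝ} (hv : 0 < v) :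
    HasDerivAt (fun v => a₂ / v ^ 2 + a₁ / v + a₀) (-(2 * a₂ / v ^ 3) - a₁ / v ^ 2) v := by
  have h1 := ((hasDerivAt_const v a₂).div ((hasDerivAt_id v).pow 2) (pow_ne_zero 2 hv.ne'))
  have h2 := ((hasDerivAt_const v a₁).div (hasDerivAt_id v) hv.ne')
  refine ((h1.add h2).add_const a₀).congr_deriv ?_
  simp only [Pi.pow_apply, id]
  field_simp
  ring

theorem hasDerivAt_exp_aux (a k : ℝ) (c : ℝ) {v : ℝ} (hv : 0 < v) :
    HasDerivAt (fun v : ℝ => a * v ^ k / c) (a * (k * v ^ (k - 1)) / c) v :=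
  ((Real.hasDerivAt_rpow_const (Or.inl hv.ne')).const_mul a).div_const c

theorem hasDerivAt_conductance (V₀ : ℝ) (ld : StaticLoad) {v : ℝ} (hv : 0 < v) :
    HasDerivAt (ld.conductance V₀) (ld.conductanceDeriv V₀ v) v := by
  cases ld with
  | zip Yp Ip Pp Yq Iq Pq => exact hasDerivAt_zip_aux Pp Ip Yp hv
  | exp P0 Q0 np nq => exact hasDerivAt_exp_aux P0 (np - 2) (V₀ ^ np) hv

theorem hasDerivAt_susceptance (V₀ : ℝ) (ld : StaticLoad) {v : ℝ} (hv : 0 < v) :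
    HasDerivAt (ld.susceptance V₀) (ld.susceptanceDeriv V₀ v) v := by
  cases ld with
  | zip Yp Ip Pp Yq Iq Pq => exact hasDerivAt_zip_aux Pq Iq Yq hv
  | exp P0 Q0 np nq => exact hasDerivAt_exp_aux Q0 (nq - 2) (V₀ ^ nq) hv

theorem continuousAt_conductanceDeriv (V₀ : ℝ) (ld : StaticLoad) {v : ℝ} (hv : 0 < v) :
    ContinuousAt (ld.conductanceDeriv V₀) v := by
  have h0 := hv.ne'
  cases ld <;> unfold conductanceDeriv <;> fun_prop (disch := simp [h0])

theorem continuousAt_susceptanceDeriv (V₀ : ℝ) (ld : StaticLoad) {v : ℝ} (hv : 0 < v) :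
    ContinuousAt (ld.susceptanceDeriv V₀) v := by
  have h0 := hv.ne'
  cases ld <;> unfold susceptanceDeriv <;> fun_prop (disch := simp [h0])

theorem contDiffAt_conductance (V₀ : ℝ) (ld : StaticLoad) {v : ℝ} (hv : 0 < v) :
    ContDiffAt ℝ 1 (ld.conductance V₀) v := by
  have h0 := hv.ne'
  cases ld <;> unfold conductance <;> fun_prop (disch := simp [h0])

theorem contDiffAt_susceptance (V₀ : ℝ) (ld : StaticLoad) {v : ℝ} (hv : 0 < v) :
    ContDiffAt ℝ 1 (ld.susceptance V₀) v := by
  have h0 := hv.ne'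
  cases ld <;> unfold susceptance <;> fun_prop (disch := simp [h0])

theorem contDiffAt_current (V₀ : ℝ) (ld : StaticLoad) {V : Fin 2 → ℝ} (hV : V ≠ 0) :
    ContDiffAt ℝ 1 (ld.current V₀) V := by
  have hv := dqAmplitude_pos hV
  rw [show ld.current V₀ = _ from funext (current_eq_radialCurrent V₀ ld)]
  exact contDiffAt_radialCurrent hV (contDiffAt_conductance V₀ ld hv)
    (contDiffAt_susceptance V₀ ld hv)

/-- Non-negative load parameters satisfying the passivity conditions at amplitude `v` give the
hypotheses of `radialCurrent_monotone` at `v`, with strict inequalities. -/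
theorem strict_of_passivityCondition {V₀ : ℝ} (hV₀ : 0 < V₀) {ld : StaticLoad} (hld : ld.Nonneg)
    {v : ℝ} (hv : 0 < v) (h : ld.PassivityCondition V₀ v) :
    0 < ld.conductance V₀ v ∧ ld.susceptanceDeriv V₀ v ^ 2 * v ^ 2 <
      4 * ld.conductance V₀ v * (ld.conductanceDeriv V₀ v * v + ld.conductance V₀ v) := by
  cases ld with
  | zip Yp Ip Pp Yq Iq Pq =>
    obtain ⟨hYp, hIp, hPp, hYq, hIq, hPq⟩ := hld
    obtain ⟨-, h2⟩ := h
    have hYp' : 0 < Yp := by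
      refine lt_of_le_of_ne hYp fun h0 => ?_
      rw [← h0] at h2
      have : 0 ≤ 1 / 4 * Iq ^ 2 * v ^ 2 + (Ip * Pp + Iq * Pq) * v + (Pp ^ 2 + Pq ^ 2) := by
        positivity
      linarith
    refine ⟨by unfold conductance; positivity, ?_⟩
    simp only [conductance, susceptanceDeriv, conductanceDeriv]
    have h3 : 4 * (Pp / v ^ 2 + Ip / v + Yp) *
        ((-(2 * Pp / v ^ 3) - Ip / v ^ 2) * v + (Pp / v ^ 2 + Ip / v + Yp)) -
        (-(2 * Pq / v ^ 3) - Iq / v ^ 2) ^ 2 * v ^ 2 =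
        4 / v ^ 4 * (Yp ^ 2 * v ^ 4 + Yp * Ip * v ^ 3 -
          ((1 / 4) * Iq ^ 2 * v ^ 2 + (Ip * Pp + Iq * Pq) * v + (Pp ^ 2 + Pq ^ 2))) := by
      field_simp
      ring
    have h4 : 0 < 4 / v ^ 4 * (Yp ^ 2 * v ^ 4 + Yp * Ip * v ^ 3 -
          ((1 / 4) * Iq ^ 2 * v ^ 2 + (Ip * Pp + Iq * Pq) * v + (Pp ^ 2 + Pq ^ 2))) :=
      mul_pos (by positivity) (sub_pos.2 h2)
    linarith
  | exp P0 Q0 np nq =>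
    obtain ⟨hP0, hQ0, hnp, hnq⟩ := hld
    obtain ⟨h1, h2⟩ := h
    have hP0' : 0 < P0 := lt_of_le_of_ne hP0 fun h0 => by rw [← h0] at h1; simp at h1
    refine ⟨by unfold conductance; positivity, ?_⟩
    simp only [conductance, susceptanceDeriv, conductanceDeriv]
    have hpow : ∀ k : ℝ, v ^ (k - 2) = v ^ k / v ^ 2 := fun k => by
      rw [Real.rpow_sub hv, Real.rpow_two]
    have hpow' : ∀ k : ℝ, v ^ (k - 2 - 1) = v ^ k / v ^ 3 := fun k => by
      rw [Real.rpow_sub hv, hpow, Real.rpow_one]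
      field_simp
    have hdbl : ∀ k : ℝ, (v / V₀) ^ (2 * k) = (v ^ k / V₀ ^ k) ^ 2 := fun k => by
      rw [← Real.div_rpow hv.le hV₀.le, mul_comm, Real.rpow_mul (by positivity), Real.rpow_two]
    rw [hdbl, hdbl] at h2
    rw [hpow, hpow', hpow']
    have ha := Real.rpow_pos_of_pos hV₀ np
    have hb := Real.rpow_pos_of_pos hV₀ nq
    have h3 : 4 * (P0 * (v ^ np / v ^ 2) / V₀ ^ np) *
        (P0 * ((np - 2) * (v ^ np / v ^ 3)) / V₀ ^ np * v + P0 * (v ^ np / v ^ 2) / V₀ ^ np) -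
        (Q0 * ((nq - 2) * (v ^ nq / v ^ 3)) / V₀ ^ nq) ^ 2 * v ^ 2 =
        1 / v ^ 4 * (4 * (np - 1) * P0 ^ 2 * (v ^ np / V₀ ^ np) ^ 2 -
          (nq - 2) ^ 2 * Q0 ^ 2 * (v ^ nq / V₀ ^ nq) ^ 2) := by
      field_simp
      ring
    have h4 := mul_pos (show 0 < 1 / v ^ 4 by positivity) (sub_pos.2 h2)
    linarith

/-- The amplitudes satisfying the passivity conditions form an interval: for ZIP loads it is
upward closed, for EXP loads the conditions compare two powers of the amplitude. -/
theorem ordConnected_passivityCondition {V₀ : ℝ} (hV₀ : 0 < V₀) {ld : StaticLoad}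
    (hld : ld.Nonneg) : {v | 0 < v ∧ ld.PassivityCondition V₀ v}.OrdConnected := by
  refine ⟨fun w hw v hv u hu => ⟨hw.1.trans_le hu.1, ?_⟩⟩
  obtain ⟨hw0, hw⟩ := hw
  obtain ⟨hv0, hv⟩ := hv
  obtain ⟨hwu, huv⟩ := hu
  have hu0 : 0 < u := hw0.trans_le hwu
  cases ld with
  | zip Yp Ip Pp Yq Iq Pq =>
    obtain ⟨hYp, hIp, hPp, hYq, hIq, hPq⟩ := hld
    obtain ⟨h1, h2⟩ := hw
    have hYp' : 0 < Yp := by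
      refine lt_of_le_of_ne hYp fun h0 => ?_
      rw [← h0] at h2
      have : 0 ≤ 1 / 4 * Iq ^ 2 * w ^ 2 + (Ip * Pp + Iq * Pq) * w + (Pp ^ 2 + Pq ^ 2) := by
        positivity
      linarith
    refine ⟨by positivity, ?_⟩
    -- Divided by `v²`, the left-hand side decreases and the right-hand side increases in `v`.
    have h3 : (1 / 4) * Iq ^ 2 + (Ip * Pp + Iq * Pq) / w + (Pp ^ 2 + Pq ^ 2) / w ^ 2
        < Yp ^ 2 * w ^ 2 + Yp * Ip * w := by
      have h4 : (1 / 4) * Iq ^ 2 + (Ip * Pp + Iq * Pq) / w + (Pp ^ 2 + Pq ^ 2) / w ^ 2 =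
          ((1 / 4) * Iq ^ 2 * w ^ 2 + (Ip * Pp + Iq * Pq) * w + (Pp ^ 2 + Pq ^ 2)) / w ^ 2 := by
        field_simp
      have h5 : Yp ^ 2 * w ^ 2 + Yp * Ip * w = (Yp ^ 2 * w ^ 4 + Yp * Ip * w ^ 3) / w ^ 2 := by
        field_simp
      rw [h4, h5]
      gcongr
    have h6 : (1 / 4) * Iq ^ 2 + (Ip * Pp + Iq * Pq) / u + (Pp ^ 2 + Pq ^ 2) / u ^ 2
        < Yp ^ 2 * u ^ 2 + Yp * Ip * u := by
      refine lt_of_le_of_lt ?_ (h3.trans_le ?_) <;> gcongr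
    have h7 := mul_lt_mul_of_pos_right h6 (show 0 < u ^ 2 by positivity)
    have h8 : ((1 / 4) * Iq ^ 2 + (Ip * Pp + Iq * Pq) / u + (Pp ^ 2 + Pq ^ 2) / u ^ 2) * u ^ 2 =
        (1 / 4) * Iq ^ 2 * u ^ 2 + (Ip * Pp + Iq * Pq) * u + (Pp ^ 2 + Pq ^ 2) := by
      field_simp
    linarith
  | exp P0 Q0 np nq =>
    refine ⟨hw.1, ?_⟩
    have hkey : ∀ t > 0, ∀ x > 0, (x / V₀) ^ (2 * np - 2 * nq) ≤ (t / V₀) ^ (2 * np - 2 * nq) →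
        (nq - 2) ^ 2 * Q0 ^ 2 * (x / V₀) ^ (2 * nq) <
          4 * (np - 1) * P0 ^ 2 * (x / V₀) ^ (2 * np) →
        (nq - 2) ^ 2 * Q0 ^ 2 * (t / V₀) ^ (2 * nq) <
          4 * (np - 1) * P0 ^ 2 * (t / V₀) ^ (2 * np) := by
      intro t ht x hx hle h
      have hdec : ∀ y : ℝ, 0 < y → (y / V₀) ^ (2 * np) =
          (y / V₀) ^ (2 * np - 2 * nq) * (y / V₀) ^ (2 * nq) := fun y hy => by
        rw [← Real.rpow_add (by positivity)]
        congr 1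
        ring
      have hxq := Real.rpow_pos_of_pos (div_pos hx hV₀) (2 * nq)
      have hxp := Real.rpow_pos_of_pos (div_pos hx hV₀) (2 * np)
      have htq := Real.rpow_pos_of_pos (div_pos ht hV₀) (2 * nq)
      have hcoef : 0 < 4 * (np - 1) * P0 ^ 2 := by
        by_contra! hneg
        have h1 : 0 ≤ (nq - 2) ^ 2 * Q0 ^ 2 * (x / V₀) ^ (2 * nq) := by positivity
        have h2 := mul_nonpos_of_nonpos_of_nonneg hneg hxp.le
        linarith
      rw [hdec x hx, ← mul_assoc] at h
      rw [hdec t ht, ← mul_assoc]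
      have h3 := lt_of_mul_lt_mul_right h hxq.le
      refine mul_lt_mul_of_pos_right (h3.trans_le ?_) htq
      gcongr
    rcases le_total 0 (2 * np - 2 * nq) with h0 | h0
    · refine hkey u hu0 w hw0 ?_ hw.2
      gcongr
    · refine hkey u hu0 v hv0 ?_ hv.2
      exact Real.rpow_le_rpow_of_nonpos (by positivity) (by gcongr) h0

theorem current_monotone {V₀ : ℝ} (hV₀ : 0 < V₀) {ld : StaticLoad} (hld : ld.Nonneg)
    {V W : Fin 2 → ℝ} (hV : ld.Admissible V₀ V) (hW : ld.Admissible V₀ W) :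
    0 ≤ (V - W) ⬝ᵥ (ld.current V₀ V - ld.current V₀ W) := by
  rw [current_eq_radialCurrent, current_eq_radialCurrent]
  have := ordConnected_passivityCondition hV₀ hld
  exact radialCurrent_monotone (s := {v | 0 < v ∧ ld.PassivityCondition V₀ v})
    (fun u hu => hu.1) (fun u hu => hasDerivAt_conductance V₀ ld hu.1)
    (fun u hu => hasDerivAt_susceptance V₀ ld hu.1)
    (fun u hu => (strict_of_passivityCondition hV₀ hld hu.1 hu.2).1.le)
    (fun u hu => (strict_of_passivityCondition hV₀ hld hu.1 hu.2).2.le)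
    ⟨dqAmplitude_pos hV.1, hV.2⟩ ⟨dqAmplitude_pos hW.1, hW.2⟩

/-- Near an admissible voltage the load current is strongly monotone: as the passivity conditions
are strict, they survive subtracting a small constant from the conductance. -/
theorem exists_strongly_monotone {V₀ : ℝ} (hV₀ : 0 < V₀) {ld : StaticLoad} (hld : ld.Nonneg)
    {W : Fin 2 → ℝ} (hW : ld.Admissible V₀ W) :
    ∃ c > 0, ∀ᶠ V in 𝓝 W,
      c * ((V - W) ⬝ᵥ (V - W)) ≤ (V - W) ⬝ᵥ (ld.current V₀ V - ld.current V₀ W) := by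
  have hw := dqAmplitude_pos hW.1
  obtain ⟨h1, h2⟩ := strict_of_passivityCondition hV₀ hld hw hW.2
  set w := dqAmplitude W with hwdef
  have hg := (hasDerivAt_conductance V₀ ld hw).continuousAt
  have hg' := continuousAt_conductanceDeriv V₀ ld hw
  have hb' := continuousAt_susceptanceDeriv V₀ ld hw
  have hgc : ContinuousAt (fun p : ℝ × ℝ => ld.conductance V₀ p.2) (0, w) :=
    ContinuousAt.comp (g := ld.conductance V₀) hg continuousAt_snd
  have hgc' : ContinuousAt (fun p : ℝ × ℝ => ld.conductanceDeriv V₀ p.2) (0, w) :=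
    ContinuousAt.comp (g := ld.conductanceDeriv V₀) hg' continuousAt_snd
  have hbc' : ContinuousAt (fun p : ℝ × ℝ => ld.susceptanceDeriv V₀ p.2) (0, w) :=
    ContinuousAt.comp (g := ld.susceptanceDeriv V₀) hb' continuousAt_snd
  have hev : ∀ᶠ p : ℝ × ℝ in 𝓝 (0, w), 0 < p.2 ∧ 0 < ld.conductance V₀ p.2 - p.1 ∧
      ld.susceptanceDeriv V₀ p.2 ^ 2 * p.2 ^ 2 < 4 * (ld.conductance V₀ p.2 - p.1) *
        (ld.conductanceDeriv V₀ p.2 * p.2 + (ld.conductance V₀ p.2 - p.1)) := by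
    refine (continuousAt_const.eventually_lt continuousAt_snd hw).and
      ((continuousAt_const.eventually_lt (hgc.sub continuousAt_fst) (by simpa using h1)).and ?_)
    exact ContinuousAt.eventually_lt (by fun_prop) (by fun_prop) (by simpa using h2)
  obtain ⟨δ, hδ, hball⟩ := Metric.nhds_basis_ball.eventually_iff.1 hev
  refine ⟨δ / 2, by positivity, ?_⟩
  have hamp := (contDiffAt_dqAmplitude hW.1).continuousAt.eventually
    (Ioo_mem_nhds (show w - δ < w by linarith) (show w < w + δ by linarith))
  have hs : ∀ u ∈ Set.Ioo (w - δ) (w + δ), 0 < u ∧ 0 < ld.conductance V₀ u - δ / 2 ∧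
      ld.susceptanceDeriv V₀ u ^ 2 * u ^ 2 < 4 * (ld.conductance V₀ u - δ / 2) *
        (ld.conductanceDeriv V₀ u * u + (ld.conductance V₀ u - δ / 2)) := by
    intro u hu
    refine hball (x := (δ / 2, u)) ?_
    rw [Metric.mem_ball, Prod.dist_eq, max_lt_iff, Real.dist_eq, Real.dist_eq]
    constructor
    · rw [sub_zero, abs_of_pos (by positivity)]
      linarith
    · rw [abs_lt]
      constructor <;> linarith [hu.1, hu.2]
  filter_upwards [hamp] with V hV
  have hmono := radialCurrent_monotone (s := Set.Ioo (w - δ) (w + δ))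
    (g := fun u => ld.conductance V₀ u - δ / 2) (b := ld.susceptance V₀)
    (fun u hu => (hs u hu).1)
    (fun u hu => (hasDerivAt_conductance V₀ ld (hs u hu).1).sub_const _)
    (fun u hu => hasDerivAt_susceptance V₀ ld (hs u hu).1)
    (fun u hu => (hs u hu).2.1.le) (fun u hu => (hs u hu).2.2.le) hV
    (show dqAmplitude W ∈ _ from ⟨by linarith, by linarith⟩)
  have hshift : ∀ U, radialCurrent (fun u => ld.conductance V₀ u - δ / 2) (ld.susceptance V₀) U =
      ld.current V₀ U - (δ / 2) • U := by
    intro U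
    rw [current_eq_radialCurrent]
    funext i
    fin_cases i <;> simp [radialCurrent] <;> ring
  rw [hshift, hshift, show ld.current V₀ V - (δ / 2) • V - (ld.current V₀ W - (δ / 2) • W) =
    (ld.current V₀ V - ld.current V₀ W) - (δ / 2) • (V - W) by rw [smul_sub]; abel,
    dotProduct_sub, dotProduct_smul, smul_eq_mul] at hmono
  linarith

/-- Local cocoercivity of the load current. -/
theorem exists_cocoercive {V₀ : ℝ} (hV₀ : 0 < V₀) {ld : StaticLoad} (hld : ld.Nonneg)
    {W : Fin 2 → ℝ} (hW : ld.Admissible V₀ W) :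
    ∃ C > 0, ∀ᶠ V in 𝓝 W,
      (ld.current V₀ V - ld.current V₀ W) ⬝ᵥ (ld.current V₀ V - ld.current V₀ W) ≤
        C * ((V - W) ⬝ᵥ (ld.current V₀ V - ld.current V₀ W)) := by
  obtain ⟨c, hc, hmono⟩ := exists_strongly_monotone hV₀ hld hW
  obtain ⟨K, s, hs, hK⟩ := (contDiffAt_current V₀ ld hW.1).exists_lipschitzOnWith
  refine ⟨(2 * K ^ 2 + 1) / c, by positivity, ?_⟩
  filter_upwards [hmono, hs] with V hV hVs
  have h1 := hK.dist_le_mul V hVs W (mem_of_mem_nhds hs)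
  rw [dist_eq_norm, dist_eq_norm] at h1
  have h2 := dotProduct_self_le_card_mul_norm_sq (ld.current V₀ V - ld.current V₀ W)
  have h3 := norm_sq_le_dotProduct_self (V - W)
  have h4 : ‖ld.current V₀ V - ld.current V₀ W‖ ^ 2 ≤ (K * ‖V - W‖) ^ 2 := by gcongr
  have h5 := dotProduct_self_nonneg_real (V - W)
  rw [Fintype.card_fin, Nat.cast_two] at h2
  have h6 : (K : ℝ) ^ 2 * ‖V - W‖ ^ 2 ≤ K ^ 2 * ((V - W) ⬝ᵥ (V - W)) := by gcongr
  calc _ ≤ (2 * (K : ℝ) ^ 2 + 1) * ((V - W) ⬝ᵥ (V - W)) := by nlinarith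
    _ = (2 * K ^ 2 + 1) / c * (c * ((V - W) ⬝ᵥ (V - W))) := by field_simp
    _ ≤ _ := by gcongr

theorem eventually_admissible {V₀ : ℝ} (hV₀ : 0 < V₀) {ld : StaticLoad} {W : Fin 2 → ℝ}
    (hW : ld.Admissible V₀ W) : ∀ᶠ V in 𝓝 W, ld.Admissible V₀ V := by
  refine (isOpen_ne.eventually_mem hW.1).and ?_
  have hw := dqAmplitude_pos hW.1
  refine (contDiffAt_dqAmplitude hW.1).continuousAt.eventually
    (p := fun v => ld.PassivityCondition V₀ v) ?_
  have hq := (div_pos hw hV₀).ne'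
  have hw2 := hw.ne'
  cases ld with
  | zip Yp Ip Pp Yq Iq Pq =>
    exact (ContinuousAt.eventually_lt (by fun_prop) (by fun_prop (disch := simpa)) hW.2.1).and
      (ContinuousAt.eventually_lt (by fun_prop) (by fun_prop) hW.2.2)
  | exp P0 Q0 np nq =>
    exact (Eventually.of_forall fun _ => hW.2.1).and
      (ContinuousAt.eventually_lt (by fun_prop (disch := simp [hw2, hV₀.ne']))
        (by fun_prop (disch := simp [hw2, hV₀.ne'])) hW.2.2)

end StaticLoad

/-! ### Closed-loop DGUs -/

theorem dqRot_transpose : dqRotᵀ = -dqRot := by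
  ext i j
  fin_cases i <;> fin_cases j <;> simp [dqRot]

theorem dotProduct_mulVec_self_of_skew {n : Type} [Fintype n] {M : Matrix n n ℝ} (hM : Mᵀ = -M)
    (v : n → ℝ) : v ⬝ᵥ (M *ᵥ v) = 0 := by
  have h : v ⬝ᵥ (M *ᵥ v) = v ⬝ᵥ (Mᵀ *ᵥ v) := by
    rw [mulVec_transpose, dotProduct_mulVec, dotProduct_comm]
  rw [hM, neg_mulVec, dotProduct_neg] at h
  linarith

namespace PHSDGU

theorem J_transpose (g : PHSDGU) (ω₀ : ℝ) : (g.J ω₀)ᵀ = -g.J ω₀ := by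
  simp only [J, fromBlocks_transpose, fromBlocks_neg, dqRot_transpose, transpose_fromCols,
    transpose_fromRows, transpose_neg, transpose_zero, diagonal_transpose, transpose_smul,
    fromRows_neg, fromCols_neg, neg_zero, neg_neg, smul_neg]

theorem Q_posDef {g : PHSDGU} (hg : g.Valid) : g.Q.PosDef := by
  obtain ⟨hL, hC, -, hν, hk⟩ := hg
  refine Matrix.PosDef.diagonal fun i => ?_
  rcases i with a | a | a
  · have := hν a; simp; positivity
  · simp; positivity
  · have := hk a; simp; positivity

/-- The skew-symmetric interconnection is lossless: only the filter currents dissipate. -/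
theorem energy_rate (g : PHSDGU) (ω₀ : ℝ) (e : DGUIx → ℝ) :
    e ⬝ᵥ (g.Q *ᵥ (((g.J ω₀ - g.R) * g.Q) *ᵥ e)) =
      ∑ a, g.alpha a * (g.Q *ᵥ e) (.inl a) ^ 2 := by
  have hQ : g.Qᵀ = g.Q := diagonal_transpose _
  rw [← mulVec_mulVec, dotProduct_mulVec, ← mulVec_transpose, hQ, sub_mulVec, dotProduct_sub,
    dotProduct_mulVec_self_of_skew (g.J_transpose ω₀), R]
  simp only [dotProduct, mulVec_diagonal, Fintype.sum_sum_type, Sum.elim_inl, Sum.elim_inr,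
    zero_mul, mul_zero, Finset.sum_const_zero, add_zero, zero_sub, ← Finset.sum_neg_distrib]
  exact Finset.sum_congr rfl fun a _ => by ring

theorem dissipative {g : PHSDGU} (hg : g.Valid) (ω₀ : ℝ) (e : DGUIx → ℝ) :
    e ⬝ᵥ (g.Q *ᵥ (((g.J ω₀ - g.R) * g.Q) *ᵥ e)) ≤ 0 := by
  rw [energy_rate]
  exact Finset.sum_nonpos fun a _ =>
    mul_nonpos_of_nonpos_of_nonneg (hg.2.2.1 a).le (sq_nonneg _)

theorem mulVec_inl (g : PHSDGU) (ω₀ : ℝ) (y : DGUIx → ℝ) (a : Fin 2) :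
    ((g.J ω₀ - g.R) *ᵥ y) (.inl a) = g.alpha a * y (.inl a) - g.nu a * y (.inr (.inl a)) := by
  simp only [sub_mulVec, J, R, fromBlocks_mulVec, Pi.sub_apply, mulVec_diagonal, Sum.elim_inl]
  fin_cases a <;> simp [fromCols_mulVec] <;> ring

theorem mulVec_inr_inl (g : PHSDGU) (ω₀ : ℝ) (y : DGUIx → ℝ) (a : Fin 2) :
    ((g.J ω₀ - g.R) *ᵥ y) (.inr (.inl a)) = g.nu a * y (.inl a) +
      ω₀ * g.Ct * (dqRot *ᵥ fun b => y (.inr (.inl b))) a - g.kI a * y (.inr (.inr a)) := by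
  simp only [sub_mulVec, J, R, fromBlocks_mulVec, Pi.sub_apply, mulVec_diagonal, Sum.elim_inr]
  fin_cases a <;> simp [fromRows_mulVec, smul_mulVec, Function.comp_def] <;> ring

/-- The closed-loop matrix is Hurwitz: on the plane spanned by the real and imaginary part of an
eigenvector with `0 ≤ Re μ` the energy balance annihilates the damped filter currents, then the rows
of the eigenvalue equation annihilate one after the other the voltages and the integrator states. -/
theorem hurwitz {g : PHSDGU} (hg : g.Valid) (ω₀ : ℝ) :
    ∀ μ ∈ spectrum ℂ (((g.J ω₀ - g.R) * g.Q).map (algebraMap ℝ ℂ)), μ.re < 0 := by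
  intro μ hμ
  by_contra! hre
  obtain ⟨p, q, hpq, hp, hq⟩ := exists_real_eigenplane hμ
  have hE := Q_posDef hg
  have hposQ : ∀ e : DGUIx → ℝ, 0 ≤ e ⬝ᵥ (g.Q *ᵥ e) := fun e => by
    simpa using hE.posSemidef.dotProduct_mulVec_nonneg e
  have hcross : p ⬝ᵥ (g.Q *ᵥ q) = q ⬝ᵥ (g.Q *ᵥ p) := by
    rw [dotProduct_mulVec, ← mulVec_transpose, Q, diagonal_transpose, dotProduct_comm]
  have hsum : p ⬝ᵥ (g.Q *ᵥ (((g.J ω₀ - g.R) * g.Q) *ᵥ p)) +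
      q ⬝ᵥ (g.Q *ᵥ (((g.J ω₀ - g.R) * g.Q) *ᵥ q)) =
      μ.re * (p ⬝ᵥ (g.Q *ᵥ p) + q ⬝ᵥ (g.Q *ᵥ q)) := by
    rw [hp, hq]
    simp only [mulVec_sub, mulVec_add, mulVec_smul, dotProduct_sub, dotProduct_add,
      dotProduct_smul, smul_eq_mul, hcross]
    ring
  have hnn : 0 ≤ μ.re * (p ⬝ᵥ (g.Q *ᵥ p) + q ⬝ᵥ (g.Q *ᵥ q)) :=
    mul_nonneg hre (add_nonneg (hposQ p) (hposQ q))
  have hdp := dissipative hg ω₀ p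
  have hdq := dissipative hg ω₀ q
  obtain ⟨hL, hC, hα, hν, hk⟩ := hg
  have hQ1 : ∀ (e : DGUIx → ℝ) a, (g.Q *ᵥ e) (.inl a) = 0 ↔ e (.inl a) = 0 := fun e a => by
    simp [Q, mulVec_diagonal, hL.ne', (hν a).ne']
  have hQ2 : ∀ (e : DGUIx → ℝ) a, (g.Q *ᵥ e) (.inr (.inl a)) = 0 ↔ e (.inr (.inl a)) = 0 :=
    fun e a => by simp [Q, mulVec_diagonal, hC.ne']
  have hQ3 : ∀ (e : DGUIx → ℝ) a, (g.Q *ᵥ e) (.inr (.inr a)) = 0 ↔ e (.inr (.inr a)) = 0 :=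
    fun e a => by simp [Q, mulVec_diagonal, (hk a).ne']
  have hcur : ∀ e : DGUIx → ℝ, e ⬝ᵥ (g.Q *ᵥ (((g.J ω₀ - g.R) * g.Q) *ᵥ e)) = 0 →
      ∀ a, e (.inl a) = 0 := by
    intro e he a
    rw [energy_rate, Finset.sum_eq_zero_iff_of_nonpos fun a _ =>
      mul_nonpos_of_nonpos_of_nonneg (hα a).le (sq_nonneg _)] at he
    rw [← hQ1]
    simpa [(hα a).ne] using he a (Finset.mem_univ a)
  have hp1 := hcur p (by linarith)
  have hq1 := hcur q (by linarith)
  have hvol : ∀ e : DGUIx → ℝ, (∀ a, e (.inl a) = 0) →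
      (∀ a, (((g.J ω₀ - g.R) * g.Q) *ᵥ e) (.inl a) = 0) → ∀ a, e (.inr (.inl a)) = 0 := by
    intro e he h a
    have h1 := h a
    rw [← mulVec_mulVec, mulVec_inl, (hQ1 e a).2 (he a)] at h1
    rw [← hQ2]
    simpa [(hν a).ne'] using h1
  have hp2 := hvol p hp1 fun a => by rw [hp]; simp [hp1, hq1]
  have hq2 := hvol q hq1 fun a => by rw [hq]; simp [hp1, hq1]
  have hint : ∀ e : DGUIx → ℝ, (∀ a, e (.inl a) = 0) → (∀ a, e (.inr (.inl a)) = 0) →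
      (∀ a, (((g.J ω₀ - g.R) * g.Q) *ᵥ e) (.inr (.inl a)) = 0) → ∀ a, e (.inr (.inr a)) = 0 := by
    intro e he he' h a
    have h1 := h a
    rw [← mulVec_mulVec, mulVec_inr_inl, (hQ1 e a).2 (he a),
      show (fun b => (g.Q *ᵥ e) (.inr (.inl b))) = 0 from funext fun b => (hQ2 e b).2 (he' b)] at h1
    rw [← hQ3]
    simpa [(hk a).ne'] using h1
  have hp3 := hint p hp1 hp2 fun a => by rw [hp]; simp [hp2, hq2]
  have hq3 := hint q hq1 hq2 fun a => by rw [hq]; simp [hp2, hq2]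
  have hzero : ∀ e : DGUIx → ℝ, (∀ a, e (.inl a) = 0) → (∀ a, e (.inr (.inl a)) = 0) →
      (∀ a, e (.inr (.inr a)) = 0) → e = 0 := by
    intro e h1 h2 h3
    funext i
    rcases i with a | a | a
    exacts [h1 a, h2 a, h3 a]
  exact hpq.elim (fun h => h (hzero p hp1 hp2 hp3)) fun h => h (hzero q hq1 hq2 hq3)

end PHSDGU

namespace PIDGU

theorem Pmat_transpose {g : PIDGU} {ω₀ : ℝ} (hg : g.Valid ω₀) : g.Pmatᵀ = g.Pmat := by
  have : g.P22ᵀ = g.P22 := hg.2.2.2.1.isHermitian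
  simp [Pmat, fromBlocks_transpose, this]

theorem Pmat_posDef {g : PIDGU} {ω₀ : ℝ} (hg : g.Valid ω₀) : g.Pmat.PosDef := by
  have hC : 0 < g.Ct := hg.2.2.1
  refine .of_dotProduct_mulVec_pos (Pmat_transpose hg) fun v hv => ?_
  have hsplit : star v ⬝ᵥ (g.Pmat *ᵥ v) = (1 / g.Ct) * ((v ∘ Sum.inl) ⬝ᵥ (v ∘ Sum.inl)) +
      (v ∘ Sum.inr) ⬝ᵥ (g.P22 *ᵥ (v ∘ Sum.inr)) := by
    rw [Pmat, fromBlocks_mulVec]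
    simp [dotProduct, Fintype.sum_sum_type, smul_mulVec]
    ring
  rw [hsplit]
  have h1 := dotProduct_self_nonneg_real (v ∘ Sum.inl)
  by_cases h2 : v ∘ Sum.inr = 0
  · have h3 : v ∘ Sum.inl ≠ 0 := fun h3 => hv (by
      funext i
      rcases i with i | i
      · exact congrFun h3 i
      · exact congrFun h2 i)
    have h4 : 0 < (v ∘ Sum.inl) ⬝ᵥ (v ∘ Sum.inl) :=
      lt_of_le_of_ne h1 fun h => h3 (dotProduct_self_eq_zero.1 h.symm)
    rw [h2, mulVec_zero, dotProduct_zero, add_zero]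
    positivity
  · have h3 := hg.2.2.2.1.dotProduct_mulVec_pos h2
    rw [star_trivial] at h3
    positivity

theorem dissipative {g : PIDGU} {ω₀ : ℝ} (hg : g.Valid ω₀) (e : DGUIx → ℝ) :
    e ⬝ᵥ (g.Pmat *ᵥ (g.F ω₀ *ᵥ e)) ≤ 0 := by
  have h := hg.2.2.2.2.1.dotProduct_mulVec_nonneg e
  rw [star_trivial, neg_mulVec, dotProduct_neg, add_mulVec, dotProduct_add, ← mulVec_mulVec,
    ← mulVec_mulVec, mulVec_transpose, dotProduct_comm e (_ ᵥ* _), ← dotProduct_mulVec,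
    dotProduct_comm, dotProduct_mulVec, ← mulVec_transpose, Pmat_transpose hg,
    dotProduct_comm] at h
  linarith

end PIDGU

namespace ControlledDGU

/-- Linear part of the closed-loop dynamics. -/
noncomputable def systemMatrix (ω₀ : ℝ) : ControlledDGU → Matrix DGUIx DGUIx ℝ
  | phs g => (g.J ω₀ - g.R) * g.Q
  | pi g => g.F ω₀

/-- Matrix through which port and load currents enter. -/
def inputMatrix : ControlledDGU → Matrix DGUIx (Fin 2) ℝ
  | phs _ => PHSDGU.K
  | pi _ => PIDGU.K

variable {g : ControlledDGU} {ω₀ : ℝ}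

theorem system_out (g : ControlledDGU) (ω₀ V₀ : ℝ) (ld : Option StaticLoad) (x : DGUIx → ℝ) :
    (g.system ω₀ V₀ ld).out x = g.voltage x := by
  cases g <;> rfl

theorem system_dyn_sub (g : ControlledDGU) (ω₀ V₀ : ℝ) (ld : Option StaticLoad)
    (x y : DGUIx → ℝ) (d d' : Fin 2 → ℝ) :
    (g.system ω₀ V₀ ld).dyn x d - (g.system ω₀ V₀ ld).dyn y d' =
      g.systemMatrix ω₀ *ᵥ (x - y) + g.inputMatrix *ᵥ ((d - d') -
        (localCurrent V₀ ld (g.voltage x) - localCurrent V₀ ld (g.voltage y))) := by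
  cases g with
  | phs g =>
    simp only [system, PHSDGU.system, systemMatrix, inputMatrix, voltage, mulVec_sub,
      ← mulVec_mulVec]
    abel
  | pi g =>
    simp only [system, PIDGU.system, systemMatrix, inputMatrix, voltage, mulVec_sub]
    abel

theorem energyMatrix_posDef (hg : g.Valid ω₀) : g.energyMatrix.PosDef := by
  cases g with
  | phs g => exact PHSDGU.Q_posDef hg
  | pi g => exact PIDGU.Pmat_posDef hg

theorem energyMatrix_transpose (hg : g.Valid ω₀) : g.energyMatrixᵀ = g.energyMatrix :=
  (energyMatrix_posDef hg).isHermitian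

theorem dissipative (hg : g.Valid ω₀) (e : DGUIx → ℝ) :
    e ⬝ᵥ (g.energyMatrix *ᵥ (g.systemMatrix ω₀ *ᵥ e)) ≤ 0 := by
  cases g with
  | phs g => exact PHSDGU.dissipative hg ω₀ e
  | pi g => exact PIDGU.dissipative hg e

theorem hurwitz (hg : g.Valid ω₀) :
    ∀ μ ∈ spectrum ℂ ((g.systemMatrix ω₀).map (algebraMap ℝ ℂ)), μ.re < 0 := by
  cases g with
  | phs g => exact PHSDGU.hurwitz hg ω₀
  | pi g => exact hg.2.2.2.2.2

/-- Port and load currents change the stored energy at the rate `(V - V̄)ᵀ w`. -/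
theorem energyMatrix_inputMatrix (g : ControlledDGU) (x y : DGUIx → ℝ) (w : Fin 2 → ℝ) :
    (x - y) ⬝ᵥ (g.energyMatrix *ᵥ (g.inputMatrix *ᵥ w)) = (g.voltage x - g.voltage y) ⬝ᵥ w := by
  cases g with
  | phs g =>
    simp [energyMatrix, inputMatrix, voltage, PHSDGU.Q, PHSDGU.K, PHSDGU.voltage, mulVec_diagonal,
      dotProduct, Fintype.sum_sum_type, fromRows_mulVec]
    ring
  | pi g =>
    simp [energyMatrix, inputMatrix, voltage, PIDGU.Pmat, PIDGU.K, PIDGU.voltage,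
      fromBlocks_mulVec, dotProduct, Fintype.sum_sum_type, fromRows_mulVec, smul_mulVec]
    ring

theorem contDiff_voltage (g : ControlledDGU) : ContDiff ℝ 1 g.voltage := by
  cases g with
  | phs g => exact contDiff_pi.2 fun a => by simp only [voltage, PHSDGU.voltage]; fun_prop
  | pi g => exact contDiff_pi.2 fun a => by simp only [voltage, PIDGU.voltage]; fun_prop

end ControlledDGU

/-! ### Dissipation in the subsystems -/

/-- A quadratic form that decays strictly along the isolated DGU and whose rate depends on the port
current `d` and the load current `I` through their squares only. The matrix `X` may be
indefinite. -/
theorem ControlledDGU.exists_strict_storage {g : ControlledDGU} {ω₀ : ℝ} (hg : g.Valid ω₀) :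
    ∃ X : Matrix DGUIx DGUIx ℝ, Xᵀ = X ∧ ∃ C > 0, ∀ (e : DGUIx → ℝ) (d I : Fin 2 → ℝ),
      e ⬝ᵥ (X *ᵥ (g.systemMatrix ω₀ *ᵥ e + g.inputMatrix *ᵥ (d - I))) ≤
        -(1 / 4) * (e ⬝ᵥ e) + C * (d ⬝ᵥ d) + C * (I ⬝ᵥ I) := by
  obtain ⟨X, hX, hlyap⟩ := exists_lyapunov_solution (hurwitz hg)
  obtain ⟨B, hB, hbd⟩ := exists_mulVec_dotProduct_self_le (X * g.inputMatrix)
  refine ⟨X, hX, 4 * B, by positivity, fun e d I => ?_⟩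
  have h1 : e ⬝ᵥ (X *ᵥ (g.systemMatrix ω₀ *ᵥ e)) = -(1 / 2) * (e ⬝ᵥ e) := by
    have h := congrArg (fun M => e ⬝ᵥ (M *ᵥ e)) hlyap
    simp only [add_mulVec, neg_mulVec, one_mulVec, dotProduct_add, dotProduct_neg,
      ← mulVec_mulVec] at h
    have h2 : e ⬝ᵥ ((g.systemMatrix ω₀)ᵀ *ᵥ (X *ᵥ e)) =
        e ⬝ᵥ (X *ᵥ (g.systemMatrix ω₀ *ᵥ e)) := by
      rw [mulVec_transpose, dotProduct_comm, ← dotProduct_mulVec, dotProduct_comm,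
        dotProduct_mulVec e X, ← mulVec_transpose, hX, dotProduct_comm]
    linarith
  have h2 := two_mul_dotProduct_le e ((X * g.inputMatrix) *ᵥ (d - I)) (t := 1 / 2) (by norm_num)
  have h3 := hbd (d - I)
  have h4 : (d - I) ⬝ᵥ (d - I) ≤ 2 * (d ⬝ᵥ d) + 2 * (I ⬝ᵥ I) := by
    have h5 := dotProduct_self_nonneg_real (d + I)
    simp only [dotProduct_add, add_dotProduct, dotProduct_sub, sub_dotProduct] at h5 ⊢
    linarith
  have h5 : B * ((d - I) ⬝ᵥ (d - I)) ≤ B * (2 * (d ⬝ᵥ d) + 2 * (I ⬝ᵥ I)) := by gcongr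
  rw [mulVec_add, dotProduct_add, h1, mulVec_mulVec]
  norm_num at h2
  nlinarith [dotProduct_self_nonneg_real d, dotProduct_self_nonneg_real I]

theorem LoadNode.rate (b : LoadNode) (ω₀ V₀ : ℝ) (x y d d' : Fin 2 → ℝ) :
    (x - y) ⬝ᵥ ((1 / b.C) • ((b.system ω₀ V₀).dyn x d - (b.system ω₀ V₀).dyn y d')) =
      -((b.voltage x - b.voltage y) ⬝ᵥ
        (b.load.current V₀ (b.voltage x) - b.load.current V₀ (b.voltage y))) +
      (b.voltage x - b.voltage y) ⬝ᵥ (d - d') := by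
  simp only [system, voltage, dotProduct, Fin.sum_univ_two, Pi.sub_apply, Pi.smul_apply,
    Pi.add_apply, smul_eq_mul, smul_mulVec, dqRot, cons_mulVec]
  simp
  ring

theorem RLLine.rate (l : RLLine) (ω₀ : ℝ) (x y : Fin 2 → ℝ) (d d' : Fin 2 ⊕ Fin 2 → ℝ) :
    (x - y) ⬝ᵥ ((1 / l.L) • ((l.system ω₀).dyn x d - (l.system ω₀).dyn y d')) =
      -(l.R * ((l.current x - l.current y) ⬝ᵥ (l.current x - l.current y))) +
      (l.current x - l.current y) ⬝ᵥ
        ((d ∘ Sum.inl - d' ∘ Sum.inl) - (d ∘ Sum.inr - d' ∘ Sum.inr)) := by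
  simp only [system, current, dotProduct, Fin.sum_univ_two, Pi.sub_apply, Pi.smul_apply,
    Pi.add_apply, smul_eq_mul, smul_mulVec, sub_mulVec, dqRot, one_mulVec, fromCols_mulVec,
    neg_mulVec, Pi.neg_apply, Function.comp_apply]
  simp [vecHead, vecTail, current]
  ring

/-- Kirchhoff's laws make the interconnection lossless: the powers entering the nodes and the lines
cancel. -/
theorem power_balance {N P : Type} [Fintype N] [Fintype P] [DecidableEq N] (src tgt : P → N)
    (V : N → Fin 2 → ℝ) (I : P → Fin 2 → ℝ) :
    ∑ k, V k ⬝ᵥ (-(∑ l with src l = k, I l) + ∑ l with tgt l = k, I l) +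
      ∑ l, I l ⬝ᵥ (V (src l) - V (tgt l)) = 0 := by
  have h : ∀ f : P → N, ∑ k, V k ⬝ᵥ (∑ l with f l = k, I l) = ∑ l, I l ⬝ᵥ V (f l) := by
    intro f
    rw [← Finset.sum_fiberwise Finset.univ f (fun l => I l ⬝ᵥ V (f l))]
    refine Finset.sum_congr rfl fun k _ => ?_
    rw [dotProduct_sum]
    refine Finset.sum_congr rfl fun l hl => ?_
    rw [(Finset.mem_filter.1 hl).2, dotProduct_comm]
  simp only [dotProduct_add, dotProduct_neg, dotProduct_sub, Finset.sum_add_distrib,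
    Finset.sum_neg_distrib, Finset.sum_sub_distrib, h]
  ring

/-- The net current injected at a node, squared, is bounded by the sum of squares of all line
currents. -/
theorem dotProduct_self_incidence_le {N P : Type} [Fintype P] [DecidableEq N]
    (src tgt : P → N) (I : P → Fin 2 → ℝ) (k : N) :
    (-(∑ l with src l = k, I l) + ∑ l with tgt l = k, I l) ⬝ᵥ
      (-(∑ l with src l = k, I l) + ∑ l with tgt l = k, I l) ≤
      4 * Fintype.card P * ∑ l, I l ⬝ᵥ I l := by
  have hsum : ∀ s : Finset P, (∑ l ∈ s, I l) ⬝ᵥ (∑ l ∈ s, I l) ≤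
      Fintype.card P * ∑ l, I l ⬝ᵥ I l := by
    intro s
    calc (∑ l ∈ s, I l) ⬝ᵥ (∑ l ∈ s, I l) = ∑ a, (∑ l ∈ s, I l a) ^ 2 := by
          simp [dotProduct, sq]
      _ ≤ ∑ a, (s.card : ℝ) * ∑ l ∈ s, I l a ^ 2 :=
          Finset.sum_le_sum fun a _ => sq_sum_le_card_mul_sum_sq
      _ = s.card * ∑ l ∈ s, I l ⬝ᵥ I l := by
          rw [← Finset.mul_sum, Finset.sum_comm]
          simp [dotProduct, sq]
      _ ≤ Fintype.card P * ∑ l, I l ⬝ᵥ I l := by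
          have hnn : 0 ≤ ∑ l ∈ s, I l ⬝ᵥ I l :=
            Finset.sum_nonneg fun l _ => dotProduct_self_nonneg_real (I l)
          gcongr
          · exact Finset.card_le_univ s
          · exact fun l _ _ => dotProduct_self_nonneg_real (I l)
          · exact Finset.subset_univ s
  have h1 := hsum {l | src l = k}
  have h2 := hsum {l | tgt l = k}
  have h3 := dotProduct_self_nonneg_real
    (∑ l with src l = k, I l + ∑ l with tgt l = k, I l)
  simp only [dotProduct_add, add_dotProduct, dotProduct_neg, neg_dotProduct] at h3 ⊢
  linarith

theorem exists_pos_forall_le {ι : Type} [Finite ι] (f : ι → ℝ) (hf : ∀ i, 0 < f i) :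
    ∃ c > 0, ∀ i, c ≤ f i := by
  obtain ⟨M, hM⟩ := Finite.exists_le fun i => (f i)⁻¹
  refine ⟨(max M 1)⁻¹, by positivity, fun i => ?_⟩
  rw [inv_le_comm₀ (by positivity) (hf i)]
  exact (hM i).trans (le_max_left M 1)

/-! ### The composite system -/

section StateSpace

variable {D L P : ℕ}

theorem dotProduct_self_eq_sum (e : MGIx D L P → ℝ) :
    e ⬝ᵥ e = ∑ i, dguState e i ⬝ᵥ dguState e i + ∑ j, loadState e j ⬝ᵥ loadState e j +
      ∑ l, lineState e l ⬝ᵥ lineState e l := by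
  simp only [dotProduct, Fintype.sum_sum_type, Fintype.sum_prod_type, dguState, loadState,
    lineState]
  ring

/-- Projection to the state of a DGU. -/
def dguProj (i : Fin D) : (MGIx D L P → ℝ) →L[ℝ] (DGUIx → ℝ) :=
  ContinuousLinearMap.pi fun a => ContinuousLinearMap.proj (.inl (i, a))

/-- Projection to the state of a load node. -/
def loadProj (j : Fin L) : (MGIx D L P → ℝ) →L[ℝ] (Fin 2 → ℝ) :=
  ContinuousLinearMap.pi fun a => ContinuousLinearMap.proj (.inr (.inl (j, a)))

/-- Projection to the state of a line. -/
def lineProj (l : Fin P) : (MGIx D L P → ℝ) →L[ℝ] (Fin 2 → ℝ) :=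
  ContinuousLinearMap.pi fun a => ContinuousLinearMap.proj (.inr (.inr (l, a)))

theorem contDiff_dguState (i : Fin D) :
    ContDiff ℝ 1 fun x : MGIx D L P → ℝ => dguState x i := (dguProj i).contDiff

end StateSpace

namespace Microgrid

variable {D L P : ℕ}

/-- The composite storage function in which the energy matrices of the DGUs are replaced by
arbitrary matrices `M i`. -/
noncomputable def storage (mg : Microgrid D L P) (M : Fin D → Matrix DGUIx DGUIx ℝ)
    (x xbar : MGIx D L P → ℝ) : ℝ :=
  (∑ i, (1 / 2 : ℝ) * ((dguState x i - dguState xbar i) ⬝ᵥ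
    (M i *ᵥ (dguState x i - dguState xbar i))))
  + (∑ j, (mg.loadNode j).hamiltonian (loadState x j) (loadState xbar j))
  + ∑ l, (mg.line l).hamiltonian (lineState x l) (lineState xbar l)

theorem hamiltonian_eq_storage (mg : Microgrid D L P) (x xbar : MGIx D L P → ℝ) :
    mg.hamiltonian x xbar = mg.storage (fun i => (mg.dgu i).energyMatrix) x xbar := rfl

theorem storage_eq (mg : Microgrid D L P) (M : Fin D → Matrix DGUIx DGUIx ℝ)
    (x xbar : MGIx D L P → ℝ) : mg.storage M x xbar =
      (∑ i, (1 / 2 : ℝ) * ((dguState (x - xbar) i) ⬝ᵥ (M i *ᵥ (dguState (x - xbar) i))))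
      + (∑ j, 1 / (2 * (mg.loadNode j).C) * (loadState (x - xbar) j ⬝ᵥ loadState (x - xbar) j))
      + ∑ l, 1 / (2 * (mg.line l).L) * (lineState (x - xbar) l ⬝ᵥ lineState (x - xbar) l) := by
  have h1 : ∀ j, (mg.loadNode j).hamiltonian (loadState x j) (loadState xbar j) =
      1 / (2 * (mg.loadNode j).C) * (loadState (x - xbar) j ⬝ᵥ loadState (x - xbar) j) := by
    intro j
    rw [LoadNode.hamiltonian, dotProduct_smul, smul_eq_mul, ← mul_assoc, one_div_mul_one_div]
    rfl
  have h2 : ∀ l, (mg.line l).hamiltonian (lineState x l) (lineState xbar l) =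
      1 / (2 * (mg.line l).L) * (lineState (x - xbar) l ⬝ᵥ lineState (x - xbar) l) := by
    intro l
    rw [RLLine.hamiltonian, dotProduct_smul, smul_eq_mul, ← mul_assoc, one_div_mul_one_div]
    rfl
  simp only [storage, h1, h2]
  rfl

theorem contDiff_hamiltonian (mg : Microgrid D L P) :
    ContDiff ℝ 1 fun p : (MGIx D L P → ℝ) × (MGIx D L P → ℝ) => mg.hamiltonian p.1 p.2 := by
  simp only [hamiltonian_eq_storage, storage_eq, dotProduct, mulVec, dguState, loadState, lineState,
    Pi.sub_apply]
  fun_prop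

theorem hasFDerivAt_storage (mg : Microgrid D L P) {M : Fin D → Matrix DGUIx DGUIx ℝ}
    (hM : ∀ i, (M i)ᵀ = M i) (x xbar : MGIx D L P → ℝ) :
    ∃ f' : (MGIx D L P → ℝ) →L[ℝ] ℝ, HasFDerivAt (fun y => mg.storage M y xbar) f' x ∧
      ∀ v, f' v =
        ∑ i, (dguState x i - dguState xbar i) ⬝ᵥ (M i *ᵥ dguState v i) +
        ∑ j, (loadState x j - loadState xbar j) ⬝ᵥ ((1 / (mg.loadNode j).C) • loadState v j) +
        ∑ l, (lineState x l - lineState xbar l) ⬝ᵥ ((1 / (mg.line l).L) • lineState v l) := by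
  have hsc : ∀ c : ℝ, (c • (1 : Matrix (Fin 2) (Fin 2) ℝ))ᵀ = c • 1 := fun c => by simp
  choose fD hfD hfD' using fun i => hasFDerivAt_quadratic (hM i) (dguProj i) x xbar
  choose fL hfL hfL' using fun j =>
    hasFDerivAt_quadratic (hsc (1 / (mg.loadNode j).C)) (loadProj j) x xbar
  choose fP hfP hfP' using fun l =>
    hasFDerivAt_quadratic (hsc (1 / (mg.line l).L)) (lineProj l) x xbar
  simp only [smul_mulVec, one_mulVec] at hfL hfL' hfP hfP'
  refine ⟨∑ i, fD i + ∑ j, fL j + ∑ l, fP l,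
    ((HasFDerivAt.fun_sum fun i _ => hfD i).add (HasFDerivAt.fun_sum fun j _ => hfL j)).add
      (HasFDerivAt.fun_sum fun l _ => hfP l), fun v => ?_⟩
  simp only [_root_.add_apply, _root_.sum_apply, hfD', hfL', hfP']
  rfl

theorem differentiable_storage (mg : Microgrid D L P) {M : Fin D → Matrix DGUIx DGUIx ℝ}
    (hM : ∀ i, (M i)ᵀ = M i) (xbar : MGIx D L P → ℝ) :
    Differentiable ℝ fun y => mg.storage M y xbar := fun x => by
  obtain ⟨f', hf', -⟩ := mg.hasFDerivAt_storage hM x xbar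
  exact hf'.differentiableAt

/-- Positive definite blocks make the storage function dominate the squared distance. -/
theorem exists_mul_dist_sq_le_storage {mg : Microgrid D L P} (hmg : mg.Valid)
    {M : Fin D → Matrix DGUIx DGUIx ℝ} {m : Fin D → ℝ} (hm : ∀ i, 0 < m i)
    (hM : ∀ i e, m i * (e ⬝ᵥ e) ≤ e ⬝ᵥ (M i *ᵥ e)) :
    ∃ c > 0, ∀ x xbar, c * dist x xbar ^ 2 ≤ mg.storage M x xbar := by
  obtain ⟨cD, hcD, hD⟩ := exists_pos_forall_le (fun i => (1 / 2) * m i)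
    fun i => by have := hm i; positivity
  obtain ⟨cL, hcL, hL⟩ := exists_pos_forall_le (fun j => 1 / (2 * (mg.loadNode j).C))
    fun j => by have := hmg.capacitance_pos j; positivity
  obtain ⟨cP, hcP, hP⟩ := exists_pos_forall_le (fun l => 1 / (2 * (mg.line l).L))
    fun l => by have := hmg.inductance_pos l; positivity
  set c := min cD (min cL cP) with hc
  have hc0 : 0 < c := lt_min hcD (lt_min hcL hcP)
  refine ⟨c, hc0, fun x xbar => ?_⟩
  have h1 := norm_sq_le_dotProduct_self (x - xbar)
  rw [dist_eq_norm, storage_eq]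
  refine (mul_le_mul_of_nonneg_left h1 hc0.le).trans ?_
  rw [dotProduct_self_eq_sum, mul_add, mul_add, Finset.mul_sum, Finset.mul_sum, Finset.mul_sum]
  refine add_le_add (add_le_add ?_ ?_) ?_
  · refine Finset.sum_le_sum fun i _ => ?_
    have h2 := hM i (dguState (x - xbar) i)
    have h3 : c ≤ 1 / 2 * m i := (min_le_left _ _).trans (hD i)
    have h4 := mul_le_mul_of_nonneg_right h3 (dotProduct_self_nonneg_real (dguState (x - xbar) i))
    linarith
  · refine Finset.sum_le_sum fun j _ => mul_le_mul_of_nonneg_right ?_ (dotProduct_self_nonneg_real _)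
    exact ((min_le_right _ _).trans (min_le_left _ _)).trans (hL j)
  · refine Finset.sum_le_sum fun l _ => mul_le_mul_of_nonneg_right ?_ (dotProduct_self_nonneg_real _)
    exact ((min_le_right _ _).trans (min_le_right _ _)).trans (hP l)

theorem exists_storage_le_mul_dist_sq (mg : Microgrid D L P)
    (M : Fin D → Matrix DGUIx DGUIx ℝ) :
    ∃ c > 0, ∀ x xbar, mg.storage M x xbar ≤ c * dist x xbar ^ 2 := by
  choose B hB hBM using fun i => exists_abs_quadratic_le (M i)
  obtain ⟨cD, hD⟩ := Finite.exists_le fun i => (1 / 2) * B i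
  obtain ⟨cL, hL⟩ := Finite.exists_le fun j => 1 / (2 * (mg.loadNode j).C)
  obtain ⟨cP, hP⟩ := Finite.exists_le fun l => 1 / (2 * (mg.line l).L)
  set c := max 0 (max cD (max cL cP)) with hc
  have hc0 : 0 ≤ c := le_max_left _ _
  have hcD : cD ≤ c := (le_max_left _ _).trans (le_max_right _ _)
  have hcL : cL ≤ c := (le_max_left _ _).trans ((le_max_right _ _).trans (le_max_right _ _))
  have hcP : cP ≤ c := (le_max_right _ _).trans ((le_max_right _ _).trans (le_max_right _ _))
  refine ⟨c * Fintype.card (MGIx D L P) + 1, by positivity, fun x xbar => ?_⟩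
  have h1 := dotProduct_self_le_card_mul_norm_sq (x - xbar)
  rw [dist_eq_norm, storage_eq]
  have h2 : (∑ i, (1 / 2 : ℝ) * ((dguState (x - xbar) i) ⬝ᵥ (M i *ᵥ (dguState (x - xbar) i))))
      + (∑ j, 1 / (2 * (mg.loadNode j).C) * (loadState (x - xbar) j ⬝ᵥ loadState (x - xbar) j))
      + ∑ l, 1 / (2 * (mg.line l).L) * (lineState (x - xbar) l ⬝ᵥ lineState (x - xbar) l) ≤
      c * ((x - xbar) ⬝ᵥ (x - xbar)) := by
    rw [dotProduct_self_eq_sum, mul_add, mul_add, Finset.mul_sum, Finset.mul_sum, Finset.mul_sum]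
    refine add_le_add (add_le_add ?_ ?_) ?_
    · refine Finset.sum_le_sum fun i _ => ?_
      have h2 := (le_abs_self _).trans (hBM i (dguState (x - xbar) i))
      have h4 := mul_le_mul_of_nonneg_right ((hD i).trans hcD)
        (dotProduct_self_nonneg_real (dguState (x - xbar) i))
      linarith
    · exact Finset.sum_le_sum fun j _ =>
        mul_le_mul_of_nonneg_right ((hL j).trans hcL) (dotProduct_self_nonneg_real _)
    · exact Finset.sum_le_sum fun l _ =>
        mul_le_mul_of_nonneg_right ((hP l).trans hcP) (dotProduct_self_nonneg_real _)
  nlinarith [mul_le_mul_of_nonneg_left h1 hc0, sq_nonneg ‖x - xbar‖]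

/-! ### Energy balance -/

/-- Voltage of DGU `i`. -/
noncomputable def dguVoltage (mg : Microgrid D L P) (x : MGIx D L P → ℝ) (i : Fin D) :
    Fin 2 → ℝ := (mg.dgu i).voltage (dguState x i)

/-- Current of the optional local load of DGU `i`. -/
noncomputable def dguLoadCurrent (mg : Microgrid D L P) (x : MGIx D L P → ℝ) (i : Fin D) :
    Fin 2 → ℝ := localCurrent mg.V₀ (mg.localLoad i) (mg.dguVoltage x i)

/-- Voltage of load node `j`. -/
noncomputable def nodeVoltage (mg : Microgrid D L P) (x : MGIx D L P → ℝ) (j : Fin L) :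
    Fin 2 → ℝ := (mg.loadNode j).voltage (loadState x j)

/-- Load current at load node `j`. -/
noncomputable def nodeLoadCurrent (mg : Microgrid D L P) (x : MGIx D L P → ℝ) (j : Fin L) :
    Fin 2 → ℝ := (mg.loadNode j).load.current mg.V₀ (mg.nodeVoltage x j)

/-- Current of line `l`. -/
noncomputable def lineCurrent (mg : Microgrid D L P) (x : MGIx D L P → ℝ) (l : Fin P) :
    Fin 2 → ℝ := (mg.line l).current (lineState x l)

theorem nodeInput_eq (mg : Microgrid D L P) (x : MGIx D L P → ℝ) (k : Fin D ⊕ Fin L) :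
    mg.nodeInput x k = -(∑ l with mg.src l = k, mg.lineCurrent x l) +
      ∑ l with mg.tgt l = k, mg.lineCurrent x l := by
  simp only [nodeInput, lineSystem, RLLine.system, Sum.elim_inl, Sum.elim_inr, Pi.neg_apply,
    neg_neg]
  rfl

theorem nodeInput_sub (mg : Microgrid D L P) (x y : MGIx D L P → ℝ) (k : Fin D ⊕ Fin L) :
    mg.nodeInput x k - mg.nodeInput y k =
      -(∑ l with mg.src l = k, (mg.lineCurrent x l - mg.lineCurrent y l)) +
      ∑ l with mg.tgt l = k, (mg.lineCurrent x l - mg.lineCurrent y l) := by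
  rw [nodeInput_eq, nodeInput_eq, Finset.sum_sub_distrib, Finset.sum_sub_distrib]
  abel

theorem nodeOutput_inl (mg : Microgrid D L P) (x : MGIx D L P → ℝ) (i : Fin D) :
    mg.nodeOutput x (.inl i) = mg.dguVoltage x i :=
  (mg.dgu i).system_out _ _ _ _

theorem dguState_field_sub (mg : Microgrid D L P) (x y : MGIx D L P → ℝ) (i : Fin D) :
    dguState (mg.field x) i - dguState (mg.field y) i =
      (mg.dgu i).systemMatrix mg.ω₀ *ᵥ (dguState x i - dguState y i) +
        (mg.dgu i).inputMatrix *ᵥ ((mg.nodeInput x (.inl i) - mg.nodeInput y (.inl i)) -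
          (mg.dguLoadCurrent x i - mg.dguLoadCurrent y i)) :=
  (mg.dgu i).system_dyn_sub mg.ω₀ mg.V₀ (mg.localLoad i) _ _ _ _

/-- The energy balance of the microgrid about an equilibrium: what remains is the dissipation in the
DGUs, the loads and the line resistances. -/
theorem energy_balance (mg : Microgrid D L P) {x xbar : MGIx D L P → ℝ} (h0 : mg.field xbar = 0) :
    ∑ i, (dguState x i - dguState xbar i) ⬝ᵥ
        ((mg.dgu i).energyMatrix *ᵥ dguState (mg.field x) i) +
      ∑ j, (loadState x j - loadState xbar j) ⬝ᵥ
        ((1 / (mg.loadNode j).C) • loadState (mg.field x) j) +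
      ∑ l, (lineState x l - lineState xbar l) ⬝ᵥ
        ((1 / (mg.line l).L) • lineState (mg.field x) l) =
    ∑ i, (dguState x i - dguState xbar i) ⬝ᵥ ((mg.dgu i).energyMatrix *ᵥ
        ((mg.dgu i).systemMatrix mg.ω₀ *ᵥ (dguState x i - dguState xbar i)))
      - ∑ i, (mg.dguVoltage x i - mg.dguVoltage xbar i) ⬝ᵥ
        (mg.dguLoadCurrent x i - mg.dguLoadCurrent xbar i)
      - ∑ j, (mg.nodeVoltage x j - mg.nodeVoltage xbar j) ⬝ᵥ
        (mg.nodeLoadCurrent x j - mg.nodeLoadCurrent xbar j)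
      - ∑ l, (mg.line l).R * ((mg.lineCurrent x l - mg.lineCurrent xbar l) ⬝ᵥ
        (mg.lineCurrent x l - mg.lineCurrent xbar l)) := by
  have hdgu : ∀ i, (dguState x i - dguState xbar i) ⬝ᵥ
      ((mg.dgu i).energyMatrix *ᵥ dguState (mg.field x) i) =
      (dguState x i - dguState xbar i) ⬝ᵥ ((mg.dgu i).energyMatrix *ᵥ
        ((mg.dgu i).systemMatrix mg.ω₀ *ᵥ (dguState x i - dguState xbar i))) -
      (mg.dguVoltage x i - mg.dguVoltage xbar i) ⬝ᵥ
        (mg.dguLoadCurrent x i - mg.dguLoadCurrent xbar i) +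
      (mg.nodeOutput x (.inl i) - mg.nodeOutput xbar (.inl i)) ⬝ᵥ
        (mg.nodeInput x (.inl i) - mg.nodeInput xbar (.inl i)) := by
    intro i
    have h1 := mg.dguState_field_sub x xbar i
    rw [h0, show dguState (0 : MGIx D L P → ℝ) i = 0 from rfl, sub_zero] at h1
    rw [h1, mulVec_add, dotProduct_add, (mg.dgu i).energyMatrix_inputMatrix, nodeOutput_inl,
      nodeOutput_inl, dotProduct_sub]
    simp only [dguVoltage]
    ring
  have hload : ∀ j, (loadState x j - loadState xbar j) ⬝ᵥ
      ((1 / (mg.loadNode j).C) • loadState (mg.field x) j) =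
      -((mg.nodeVoltage x j - mg.nodeVoltage xbar j) ⬝ᵥ
        (mg.nodeLoadCurrent x j - mg.nodeLoadCurrent xbar j)) +
      (mg.nodeOutput x (.inr j) - mg.nodeOutput xbar (.inr j)) ⬝ᵥ
        (mg.nodeInput x (.inr j) - mg.nodeInput xbar (.inr j)) := by
    intro j
    have h1 := (mg.loadNode j).rate mg.ω₀ mg.V₀ (loadState x j) (loadState xbar j)
      (mg.nodeInput x (.inr j)) (mg.nodeInput xbar (.inr j))
    rw [show ((mg.loadNode j).system mg.ω₀ mg.V₀).dyn (loadState xbar j)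
      (mg.nodeInput xbar (.inr j)) = 0 from congrArg (fun y => loadState y j) h0, sub_zero] at h1
    exact h1
  have hline : ∀ l, (lineState x l - lineState xbar l) ⬝ᵥ
      ((1 / (mg.line l).L) • lineState (mg.field x) l) =
      -((mg.line l).R * ((mg.lineCurrent x l - mg.lineCurrent xbar l) ⬝ᵥ
        (mg.lineCurrent x l - mg.lineCurrent xbar l))) +
      (mg.lineCurrent x l - mg.lineCurrent xbar l) ⬝ᵥ
        ((mg.nodeOutput x (mg.src l) - mg.nodeOutput xbar (mg.src l)) -
          (mg.nodeOutput x (mg.tgt l) - mg.nodeOutput xbar (mg.tgt l))) := by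
    intro l
    have h1 := (mg.line l).rate mg.ω₀ (lineState x l) (lineState xbar l)
      (mg.lineInput x l) (mg.lineInput xbar l)
    rw [show ((mg.line l).system mg.ω₀).dyn (lineState xbar l)
      (mg.lineInput xbar l) = 0 from congrArg (fun y => lineState y l) h0, sub_zero] at h1
    exact h1
  have hpow := power_balance mg.src mg.tgt (fun k => mg.nodeOutput x k - mg.nodeOutput xbar k)
    (fun l => mg.lineCurrent x l - mg.lineCurrent xbar l)
  simp only [← nodeInput_sub, Fintype.sum_sum_type] at hpow
  simp only [hdgu, hload, hline, Finset.sum_add_distrib, Finset.sum_sub_distrib,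
    Finset.sum_neg_distrib]
  linarith

end Microgrid

/-! ### Regularity of the vector field -/

theorem ContDiffAt.matrix_mulVec {E m n : Type} [NormedAddCommGroup E] [NormedSpace ℝ E]
    [Fintype m] [Fintype n] (M : Matrix m n ℝ) {u : E → n → ℝ} {x : E}
    (hu : ContDiffAt ℝ 1 u x) : ContDiffAt ℝ 1 (fun x => M *ᵥ u x) x := by
  rw [contDiffAt_pi] at hu ⊢
  intro i
  simp only [mulVec, dotProduct]
  fun_prop

theorem contDiffAt_localCurrent {V₀ : ℝ} {o : Option StaticLoad} {V : Fin 2 → ℝ}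
    (h : ∀ ld ∈ o, V ≠ 0) : ContDiffAt ℝ 1 (localCurrent V₀ o) V := by
  cases o with
  | none => exact contDiffAt_const (c := (0 : Fin 2 → ℝ))
  | some ld => exact ld.contDiffAt_current V₀ (h ld rfl)

namespace Microgrid

variable {D L P : ℕ} (mg : Microgrid D L P)

theorem contDiff_dguVoltage (i : Fin D) : ContDiff ℝ 1 fun x => mg.dguVoltage x i :=
  (mg.dgu i).contDiff_voltage.comp (contDiff_dguState i)

theorem contDiff_nodeVoltage (j : Fin L) : ContDiff ℝ 1 fun x => mg.nodeVoltage x j := by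
  refine contDiff_pi.2 fun a => ?_
  simp only [nodeVoltage, LoadNode.voltage, loadState]
  fun_prop

theorem contDiff_nodeOutput (k : Fin D ⊕ Fin L) : ContDiff ℝ 1 fun x => mg.nodeOutput x k := by
  rcases k with i | j
  · simp only [nodeOutput_inl]
    exact mg.contDiff_dguVoltage i
  · exact mg.contDiff_nodeVoltage j

theorem contDiff_nodeInput (k : Fin D ⊕ Fin L) : ContDiff ℝ 1 fun x => mg.nodeInput x k := by
  refine contDiff_pi.2 fun a => ?_
  simp only [nodeInput_eq, Pi.add_apply, Pi.neg_apply, Finset.sum_apply, lineCurrent,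
    RLLine.current, lineState]
  fun_prop

theorem contDiff_lineInput (l : Fin P) : ContDiff ℝ 1 fun x => mg.lineInput x l := by
  refine contDiff_pi.2 fun a => ?_
  rcases a with a | a
  · exact contDiff_pi.1 (mg.contDiff_nodeOutput (mg.src l)) a
  · exact contDiff_pi.1 (mg.contDiff_nodeOutput (mg.tgt l)) a

theorem contDiffAt_dguLoadCurrent {x : MGIx D L P → ℝ} (hx : x ∈ mg.admissible) (i : Fin D) :
    ContDiffAt ℝ 1 (fun x => mg.dguLoadCurrent x i) x :=
  ContDiffAt.comp x (g := localCurrent mg.V₀ (mg.localLoad i))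
    (contDiffAt_localCurrent fun ld hld => (hx.1 i ld hld).1) (mg.contDiff_dguVoltage i).contDiffAt

theorem contDiffAt_nodeLoadCurrent {x : MGIx D L P → ℝ} (hx : x ∈ mg.admissible) (j : Fin L) :
    ContDiffAt ℝ 1 (fun x => mg.nodeLoadCurrent x j) x :=
  ContDiffAt.comp x (g := (mg.loadNode j).load.current mg.V₀)
    ((mg.loadNode j).load.contDiffAt_current mg.V₀ (hx.2 j).1)
    (mg.contDiff_nodeVoltage j).contDiffAt

theorem contDiffAt_field {x : MGIx D L P → ℝ} (hx : x ∈ mg.admissible) :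
    ContDiffAt ℝ 1 mg.field x := by
  have hdgu : ∀ i, ContDiffAt ℝ 1 (fun y => dguState (mg.field y) i) x := by
    intro i
    have h1 : (fun y => dguState (mg.field y) i) = fun y => dguState (mg.field x) i +
        ((mg.dgu i).systemMatrix mg.ω₀ *ᵥ (dguState y i - dguState x i) +
          (mg.dgu i).inputMatrix *ᵥ ((mg.nodeInput y (.inl i) - mg.nodeInput x (.inl i)) -
            (mg.dguLoadCurrent y i - mg.dguLoadCurrent x i))) := by
      funext y
      rw [← mg.dguState_field_sub y x i]
      abel
    rw [h1]
    have h2 := (contDiff_dguState (D := D) (L := L) (P := P) i).contDiffAt (x := x)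
    have h3 := (mg.contDiff_nodeInput (.inl i)).contDiffAt (x := x)
    have h4 := mg.contDiffAt_dguLoadCurrent hx i
    exact contDiffAt_const.add (((h2.sub contDiffAt_const).matrix_mulVec _).add
      (((h3.sub contDiffAt_const).sub (h4.sub contDiffAt_const)).matrix_mulVec _))
  have hload : ∀ j, ContDiffAt ℝ 1 (fun y => loadState (mg.field y) j) x := fun j =>
    (((mg.contDiff_nodeVoltage j).contDiffAt.matrix_mulVec _).sub
      (mg.contDiffAt_nodeLoadCurrent hx j)).add (mg.contDiff_nodeInput (.inr j)).contDiffAt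
  have hcur : ∀ l, ContDiffAt ℝ 1 (fun y => mg.lineCurrent y l) x := by
    intro l
    refine contDiffAt_pi.2 fun a => ?_
    simp only [lineCurrent, RLLine.current, lineState]
    fun_prop
  have hline : ∀ l, ContDiffAt ℝ 1 (fun y => lineState (mg.field y) l) x := fun l =>
    ((hcur l).matrix_mulVec _).add ((mg.contDiff_lineInput l).contDiffAt.matrix_mulVec _)
  refine contDiffAt_pi.2 fun k => ?_
  rcases k with ⟨i, a⟩ | ⟨j, a⟩ | ⟨l, a⟩
  · exact contDiffAt_pi.1 (hdgu i) a
  · exact contDiffAt_pi.1 (hload j) a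
  · exact contDiffAt_pi.1 (hline l) a

variable {mg}

theorem admissible_mem_nhds (hmg : mg.Valid) {xbar : MGIx D L P → ℝ} (hx : xbar ∈ mg.admissible) :
    mg.admissible ∈ 𝓝 xbar := by
  have h1 : ∀ᶠ x in 𝓝 xbar, ∀ i, ∀ ld ∈ mg.localLoad i,
      ld.Admissible mg.V₀ (mg.dguVoltage x i) := by
    refine eventually_all.2 fun i => ?_
    cases hi : mg.localLoad i with
    | none => exact Eventually.of_forall fun x ld hld => by simp at hld
    | some ld' =>
      have h := (mg.contDiff_dguVoltage i).continuous.continuousAt.eventually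
        (StaticLoad.eventually_admissible hmg.nominal_pos (hx.1 i ld' hi))
      filter_upwards [h] with x hx ld hld
      rw [Option.mem_some_iff] at hld
      exact hld ▸ hx
  have h2 : ∀ᶠ x in 𝓝 xbar, ∀ j, (mg.loadNode j).load.Admissible mg.V₀ (mg.nodeVoltage x j) :=
    eventually_all.2 fun j => (mg.contDiff_nodeVoltage j).continuous.continuousAt.eventually
      (StaticLoad.eventually_admissible hmg.nominal_pos (hx.2 j))
  filter_upwards [h1, h2] with x h1 h2 using ⟨h1, h2⟩

/-! ### Passivity and asymptotic stability -/

theorem dguLoad_monotone (hmg : mg.Valid) {x xbar : MGIx D L P → ℝ} (hx : x ∈ mg.admissible)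
    (hxbar : xbar ∈ mg.admissible) (i : Fin D) :
    0 ≤ (mg.dguVoltage x i - mg.dguVoltage xbar i) ⬝ᵥ
      (mg.dguLoadCurrent x i - mg.dguLoadCurrent xbar i) := by
  unfold dguLoadCurrent
  cases hi : mg.localLoad i with
  | none => simp [localCurrent]
  | some ld =>
    exact StaticLoad.current_monotone hmg.nominal_pos (hmg.localLoad_nonneg i ld hi)
      (hx.1 i ld hi) (hxbar.1 i ld hi)

theorem nodeLoad_monotone (hmg : mg.Valid) {x xbar : MGIx D L P → ℝ} (hx : x ∈ mg.admissible)
    (hxbar : xbar ∈ mg.admissible) (j : Fin L) :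
    0 ≤ (mg.nodeVoltage x j - mg.nodeVoltage xbar j) ⬝ᵥ
      (mg.nodeLoadCurrent x j - mg.nodeLoadCurrent xbar j) :=
  StaticLoad.current_monotone hmg.nominal_pos (hmg.load_nonneg j) (hx.2 j) (hxbar.2 j)

theorem fderiv_hamiltonian_nonpos (hmg : mg.Valid) {x xbar : MGIx D L P → ℝ}
    (hx : x ∈ mg.admissible) (hxbar : xbar ∈ mg.admissible) (h0 : mg.field xbar = 0) :
    fderiv ℝ (fun y => mg.hamiltonian y xbar) x (mg.field x) ≤ 0 := by
  obtain ⟨f', hf', hval⟩ := mg.hasFDerivAt_storage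
    (fun i => ControlledDGU.energyMatrix_transpose (hmg.dgu_valid i)) x xbar
  rw [show (fun y => mg.hamiltonian y xbar) = _ from
    funext fun y => mg.hamiltonian_eq_storage y xbar, hf'.fderiv, hval, mg.energy_balance h0]
  have h1 := Finset.sum_nonpos fun i (_ : i ∈ Finset.univ) =>
    ControlledDGU.dissipative (hmg.dgu_valid i) (dguState x i - dguState xbar i)
  have h2 := Finset.sum_nonneg fun i (_ : i ∈ Finset.univ) => dguLoad_monotone hmg hx hxbar i
  have h3 := Finset.sum_nonneg fun j (_ : j ∈ Finset.univ) => nodeLoad_monotone hmg hx hxbar j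
  have h4 := Finset.sum_nonneg fun l (_ : l ∈ Finset.univ) =>
    mul_nonneg (hmg.resistance_pos l).le
      (dotProduct_self_nonneg_real (mg.lineCurrent x l - mg.lineCurrent xbar l))
  linarith

theorem exists_mul_dist_sq_le_hamiltonian (hmg : mg.Valid) :
    ∃ c > 0, ∀ x xbar, c * dist x xbar ^ 2 ≤ mg.hamiltonian x xbar := by
  choose m hm hM using fun i =>
    (ControlledDGU.energyMatrix_posDef (hmg.dgu_valid i)).exists_mul_le_quadratic
  exact exists_mul_dist_sq_le_storage hmg hm hM

theorem hamiltonian_self (xbar : MGIx D L P → ℝ) : mg.hamiltonian xbar xbar = 0 := by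
  simp [hamiltonian, ControlledDGU.hamiltonian, LoadNode.hamiltonian, RLLine.hamiltonian]

theorem isEIPWith_hamiltonian (hmg : mg.Valid) :
    mg.composite.IsEIPWith mg.admissible mg.hamiltonian := by
  obtain ⟨c, hc, hlow⟩ := exists_mul_dist_sq_le_hamiltonian hmg
  refine ⟨mg.contDiff_hamiltonian, fun x xbar => le_trans (by positivity) (hlow x xbar),
    hamiltonian_self, fun x hx xbar hxbar d dbar h0 => ?_⟩
  simpa [composite] using fderiv_hamiltonian_nonpos hmg hx hxbar h0

theorem isLyapunovFunctionOn_hamiltonian (hmg : mg.Valid) {xbar : MGIx D L P → ℝ}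
    (hxbar : xbar ∈ mg.admissible) (h0 : mg.field xbar = 0) :
    IsLyapunovFunctionOn mg.field mg.admissible xbar fun x => mg.hamiltonian x xbar := by
  obtain ⟨c, hc, hlow⟩ := exists_mul_dist_sq_le_hamiltonian hmg
  have hsmooth : ContDiff ℝ 1 fun x => mg.hamiltonian x xbar :=
    mg.contDiff_hamiltonian.comp (f := fun x => (x, xbar)) (contDiff_id.prodMk contDiff_const)
  refine ⟨admissible_mem_nhds hmg hxbar, hsmooth, hamiltonian_self xbar,
    fun x hx => ?_, fun x hx => fderiv_hamiltonian_nonpos hmg hx hxbar h0⟩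
  have h1 := dist_pos.2 hx
  exact lt_of_lt_of_le (by positivity) (hlow x xbar)

/-- Without a local load both sides vanish. -/
theorem dguLoad_cocoercive (hmg : mg.Valid) {xbar : MGIx D L P → ℝ}
    (hxbar : xbar ∈ mg.admissible) (i : Fin D) : ∃ C > 0, ∀ᶠ x in 𝓝 xbar,
      (mg.dguLoadCurrent x i - mg.dguLoadCurrent xbar i) ⬝ᵥ
        (mg.dguLoadCurrent x i - mg.dguLoadCurrent xbar i) ≤
      C * ((mg.dguVoltage x i - mg.dguVoltage xbar i) ⬝ᵥ
        (mg.dguLoadCurrent x i - mg.dguLoadCurrent xbar i)) := by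
  unfold dguLoadCurrent
  cases hi : mg.localLoad i with
  | none => exact ⟨1, one_pos, Eventually.of_forall fun x => by simp [localCurrent]⟩
  | some ld =>
    obtain ⟨C, hC, h⟩ := StaticLoad.exists_cocoercive hmg.nominal_pos
      (hmg.localLoad_nonneg i ld hi) (hxbar.1 i ld hi)
    exact ⟨C, hC, (mg.contDiff_dguVoltage i).continuous.continuousAt.eventually h⟩

theorem nodeLoad_strongly_monotone (hmg : mg.Valid) {xbar : MGIx D L P → ℝ}
    (hxbar : xbar ∈ mg.admissible) (j : Fin L) : ∃ c > 0, ∀ᶠ x in 𝓝 xbar,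
      c * ((loadState x j - loadState xbar j) ⬝ᵥ (loadState x j - loadState xbar j)) ≤
        (mg.nodeVoltage x j - mg.nodeVoltage xbar j) ⬝ᵥ
          (mg.nodeLoadCurrent x j - mg.nodeLoadCurrent xbar j) := by
  obtain ⟨c, hc, h⟩ := StaticLoad.exists_strongly_monotone hmg.nominal_pos
    (hmg.load_nonneg j) (hxbar.2 j)
  have hC := hmg.capacitance_pos j
  refine ⟨c / (mg.loadNode j).C ^ 2, by positivity, ?_⟩
  filter_upwards [(mg.contDiff_nodeVoltage j).continuous.continuousAt.eventually h] with x hx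
  refine le_trans (le_of_eq ?_) hx
  simp only [dotProduct, Fin.sum_univ_two, Pi.sub_apply, LoadNode.voltage, nodeVoltage]
  field_simp

theorem lineCurrent_sub_dotProduct_self (mg : Microgrid D L P) (x y : MGIx D L P → ℝ) (l : Fin P) :
    (mg.lineCurrent x l - mg.lineCurrent y l) ⬝ᵥ (mg.lineCurrent x l - mg.lineCurrent y l) =
      1 / (mg.line l).L ^ 2 *
        ((lineState x l - lineState y l) ⬝ᵥ (lineState x l - lineState y l)) := by
  simp only [dotProduct, Fin.sum_univ_two, Pi.sub_apply, lineCurrent, RLLine.current]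
  ring

/-- Asymptotic stability, from the strict Lyapunov function that results from adding a small
multiple of the forms `eᵀ X e / 2`, with `X` solving the Lyapunov equation of the isolated DGU, to
the Hamiltonian. The cross terms are absorbed by the dissipation in the lines and the local
loads. -/
theorem isAsymptoticallyStable (hmg : mg.Valid) {xbar : MGIx D L P → ℝ}
    (hxbar : xbar ∈ mg.admissible) (h0 : mg.field xbar = 0) :
    IsAsymptoticallyStable mg.field xbar := by
  choose X hX C hC hXC using fun i => ControlledDGU.exists_strict_storage (hmg.dgu_valid i)
  choose G hG hcoc using dguLoad_cocoercive hmg hxbar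
  choose s hs hstrong using nodeLoad_strongly_monotone hmg hxbar
  choose m hm hE using fun i =>
    (ControlledDGU.energyMatrix_posDef (hmg.dgu_valid i)).exists_mul_le_quadratic
  choose B hB hXB using fun i => exists_abs_quadratic_le (X i)
  obtain ⟨r, hr, hrR⟩ := exists_pos_forall_le (fun l => (mg.line l).R) hmg.resistance_pos
  -- Smallness of `ε`: positive definiteness of the storage matrices, and absorption of the cross
  -- terms due to the local loads and to the lines.
  have hCsum : 0 ≤ ∑ i, C i := Finset.sum_nonneg fun i _ => (hC i).le
  obtain ⟨ε₁, hε₁, hle₁⟩ := exists_pos_forall_le (fun i => min (m i / (2 * B i)) (1 / (C i * G i)))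
    fun i => by
      have := hm i; have := hB i; have := hC i; have := hG i
      exact lt_min (by positivity) (by positivity)
  obtain ⟨ε, hε, hεε₁, hεr⟩ : ∃ ε > 0, ε ≤ ε₁ ∧ ε * ((∑ i, C i) * (4 * P)) ≤ r / 2 := by
    refine ⟨min ε₁ (r / 2 / ((∑ i, C i) * (4 * P) + 1)), lt_min hε₁ (by positivity),
      min_le_left _ _, ?_⟩
    have h1 : min ε₁ (r / 2 / ((∑ i, C i) * (4 * P) + 1)) * ((∑ i, C i) * (4 * P) + 1) ≤ r / 2 := by
      rw [← le_div_iff₀ (by positivity)]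
      exact min_le_right _ _
    have h2 : 0 < min ε₁ (r / 2 / ((∑ i, C i) * (4 * P) + 1)) := lt_min hε₁ (by positivity)
    linarith
  have hεB : ∀ i, ε * B i ≤ m i / 2 := fun i => by
    have h1 := hεε₁.trans ((hle₁ i).trans (min_le_left _ _))
    have h2 := hB i
    rw [le_div_iff₀ (by positivity)] at h1
    linarith
  have hεCG : ∀ i, ε * (C i * G i) ≤ 1 := fun i => by
    have h1 := hεε₁.trans ((hle₁ i).trans (min_le_right _ _))
    have h2 := mul_pos (hC i) (hG i)
    rwa [le_div_iff₀ h2] at h1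
  let M : Fin D → Matrix DGUIx DGUIx ℝ := fun i => (mg.dgu i).energyMatrix + ε • X i
  have hMt : ∀ i, (M i)ᵀ = M i := fun i => by
    simp [M, ControlledDGU.energyMatrix_transpose (hmg.dgu_valid i), hX i]
  have hMpos : ∀ i e, m i / 2 * (e ⬝ᵥ e) ≤ e ⬝ᵥ (M i *ᵥ e) := fun i e => by
    simp only [M, add_mulVec, smul_mulVec, dotProduct_add, dotProduct_smul, smul_eq_mul]
    have h1 := mul_le_mul_of_nonneg_left ((abs_le.1 (hXB i e)).1) hε.le
    have h2 := mul_le_mul_of_nonneg_right (hεB i) (dotProduct_self_nonneg_real e)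
    linarith [hE i e]
  obtain ⟨c₁, hc₁, hlow⟩ := exists_mul_dist_sq_le_storage hmg (fun i => half_pos (hm i)) hMpos
  obtain ⟨c₂, hc₂, hup⟩ := mg.exists_storage_le_mul_dist_sq M
  obtain ⟨s₀, hs₀, hsle⟩ := exists_pos_forall_le s hs
  obtain ⟨p₀, hp₀, hple⟩ := exists_pos_forall_le (fun l => r / 2 * (1 / (mg.line l).L ^ 2))
    fun l => by have := hmg.inductance_pos l; positivity
  set κ := min (ε / 4) (min s₀ p₀) with hκ
  have hκ0 : 0 < κ := lt_min (by positivity) (lt_min hs₀ hp₀)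
  refine isAsymptoticallyStable_of_lyapunov h0 (mg.contDiffAt_field hxbar)
    (W := fun x => mg.storage M x xbar) (mg.differentiable_storage hMt xbar) hc₁ hc₂ hκ0
    (fun x => hlow x xbar) (fun x => hup x xbar) ?_
  filter_upwards [admissible_mem_nhds hmg hxbar, eventually_all.2 hcoc, eventually_all.2 hstrong]
    with x hx hcoc hstrong
  obtain ⟨f', hf', hval⟩ := mg.hasFDerivAt_storage hMt x xbar
  rw [hf'.fderiv, hval]
  have hbal := mg.energy_balance (x := x) h0
  have hdiss := Finset.sum_nonpos fun i (_ : i ∈ Finset.univ) =>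
    ControlledDGU.dissipative (hmg.dgu_valid i) (dguState x i - dguState xbar i)
  -- Contribution of `X i`.
  have hcross : ∀ i, ε * ((dguState x i - dguState xbar i) ⬝ᵥ
      (X i *ᵥ dguState (mg.field x) i)) ≤
      -(ε / 4) * ((dguState x i - dguState xbar i) ⬝ᵥ (dguState x i - dguState xbar i)) +
      ε * C i * (4 * P * ∑ l, (mg.lineCurrent x l - mg.lineCurrent xbar l) ⬝ᵥ
        (mg.lineCurrent x l - mg.lineCurrent xbar l)) +
      (mg.dguVoltage x i - mg.dguVoltage xbar i) ⬝ᵥ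
        (mg.dguLoadCurrent x i - mg.dguLoadCurrent xbar i) := by
    intro i
    have h1 := mg.dguState_field_sub x xbar i
    rw [h0, show dguState (0 : MGIx D L P → ℝ) i = 0 from rfl, sub_zero] at h1
    have h2 := hXC i (dguState x i - dguState xbar i)
      (mg.nodeInput x (.inl i) - mg.nodeInput xbar (.inl i))
      (mg.dguLoadCurrent x i - mg.dguLoadCurrent xbar i)
    rw [← h1] at h2
    have h3 := dotProduct_self_incidence_le mg.src mg.tgt
      (fun l => mg.lineCurrent x l - mg.lineCurrent xbar l) (.inl i)
    rw [← nodeInput_sub, Fintype.card_fin] at h3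
    have h4 := mul_le_mul_of_nonneg_left h2 hε.le
    have h5 := mul_le_mul_of_nonneg_left h3 (mul_nonneg hε.le (hC i).le)
    have h6 := mul_le_mul_of_nonneg_left (hcoc i) (mul_nonneg hε.le (hC i).le)
    have h7 := mul_le_mul_of_nonneg_right (hεCG i) (dguLoad_monotone hmg hx hxbar i)
    linarith
  have hcross' := Finset.sum_le_sum fun i (_ : i ∈ Finset.univ) => hcross i
  simp only [Finset.sum_add_distrib, ← Finset.sum_mul, ← Finset.mul_sum] at hcross'
  have hstrong' : s₀ * ∑ j, (loadState x j - loadState xbar j) ⬝ᵥ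
      (loadState x j - loadState xbar j) ≤ ∑ j, (mg.nodeVoltage x j - mg.nodeVoltage xbar j) ⬝ᵥ
      (mg.nodeLoadCurrent x j - mg.nodeLoadCurrent xbar j) := by
    rw [Finset.mul_sum]
    exact Finset.sum_le_sum fun j _ =>
      (mul_le_mul_of_nonneg_right (hsle j) (dotProduct_self_nonneg_real _)).trans (hstrong j)
  have hres : r * ∑ l, (mg.lineCurrent x l - mg.lineCurrent xbar l) ⬝ᵥ
      (mg.lineCurrent x l - mg.lineCurrent xbar l) ≤
      ∑ l, (mg.line l).R * ((mg.lineCurrent x l - mg.lineCurrent xbar l) ⬝ᵥ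
        (mg.lineCurrent x l - mg.lineCurrent xbar l)) := by
    rw [Finset.mul_sum]
    exact Finset.sum_le_sum fun l _ =>
      mul_le_mul_of_nonneg_right (hrR l) (dotProduct_self_nonneg_real _)
  have hcur : p₀ * ∑ l, (lineState x l - lineState xbar l) ⬝ᵥ (lineState x l - lineState xbar l) ≤
      r / 2 * ∑ l, (mg.lineCurrent x l - mg.lineCurrent xbar l) ⬝ᵥ
        (mg.lineCurrent x l - mg.lineCurrent xbar l) := by
    rw [Finset.mul_sum, Finset.mul_sum]
    refine Finset.sum_le_sum fun l _ => ?_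
    rw [mg.lineCurrent_sub_dotProduct_self, ← mul_assoc]
    exact mul_le_mul_of_nonneg_right (hple l) (dotProduct_self_nonneg_real _)
  have hI0 : 0 ≤ ∑ l, (mg.lineCurrent x l - mg.lineCurrent xbar l) ⬝ᵥ
      (mg.lineCurrent x l - mg.lineCurrent xbar l) :=
    Finset.sum_nonneg fun l _ => dotProduct_self_nonneg_real _
  have hεr' := mul_le_mul_of_nonneg_right hεr hI0
  have hsplit : ∑ i, (dguState x i - dguState xbar i) ⬝ᵥ (M i *ᵥ dguState (mg.field x) i) =
      ∑ i, (dguState x i - dguState xbar i) ⬝ᵥ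
        ((mg.dgu i).energyMatrix *ᵥ dguState (mg.field x) i) +
      ε * ∑ i, (dguState x i - dguState xbar i) ⬝ᵥ (X i *ᵥ dguState (mg.field x) i) := by
    simp only [M, add_mulVec, smul_mulVec, dotProduct_add, dotProduct_smul, smul_eq_mul,
      Finset.sum_add_distrib, Finset.mul_sum]
  have hnorm : κ * dist x xbar ^ 2 ≤
      κ * (∑ i, (dguState x i - dguState xbar i) ⬝ᵥ (dguState x i - dguState xbar i) +
        ∑ j, (loadState x j - loadState xbar j) ⬝ᵥ (loadState x j - loadState xbar j) +
        ∑ l, (lineState x l - lineState xbar l) ⬝ᵥ (lineState x l - lineState xbar l)) := by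
    refine mul_le_mul_of_nonneg_left ?_ hκ0.le
    rw [dist_eq_norm]
    exact (norm_sq_le_dotProduct_self (x - xbar)).trans (dotProduct_self_eq_sum (x - xbar)).le
  have hD0 : 0 ≤ ∑ i, (dguState x i - dguState xbar i) ⬝ᵥ (dguState x i - dguState xbar i) :=
    Finset.sum_nonneg fun i _ => dotProduct_self_nonneg_real _
  have hL0 : 0 ≤ ∑ j, (loadState x j - loadState xbar j) ⬝ᵥ (loadState x j - loadState xbar j) :=
    Finset.sum_nonneg fun j _ => dotProduct_self_nonneg_real _
  have hP0 : 0 ≤ ∑ l, (lineState x l - lineState xbar l) ⬝ᵥ (lineState x l - lineState xbar l) :=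
    Finset.sum_nonneg fun l _ => dotProduct_self_nonneg_real _
  have hk1 := mul_le_mul_of_nonneg_right (show κ ≤ ε / 4 from min_le_left _ _) hD0
  have hk2 := mul_le_mul_of_nonneg_right
    (show κ ≤ s₀ from (min_le_right _ _).trans (min_le_left _ _)) hL0
  have hk3 := mul_le_mul_of_nonneg_right
    (show κ ≤ p₀ from (min_le_right _ _).trans (min_le_right _ _)) hP0
  rw [hsplit]
  linarith

end Microgrid

theorem theorem1 {D L P : ℕ} (mg : Microgrid D L P) (hmg : mg.Valid) :
    mg.composite.IsEIPWith mg.admissible mg.hamiltonian ∧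
    ∀ xbar ∈ mg.admissible, mg.field xbar = 0 →
      IsLyapunovFunctionOn mg.field mg.admissible xbar (fun x => mg.hamiltonian x xbar) ∧
      IsAsymptoticallyStable mg.field xbar :=
  ⟨Microgrid.isEIPWith_hamiltonian hmg, fun _ hxbar h0 =>
    ⟨Microgrid.isLyapunovFunctionOn_hamiltonian hmg hxbar h0,
      Microgrid.isAsymptoticallyStable hmg hxbar h0⟩⟩
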